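/- **Setting.** Let $\mathbb F$ be a field of characteristic $0$ and $\mathcal V$ a differential algebra over $\mathbb F$: a unital commutative associative $\mathbb F$-algebra with an $\mathbb F$-linear derivation $\partial$. Let $\int:\mathcal V\to\mathcal V/\partial\mathcal V$ be the quotient map, and $\mathcal V((\partial^{-1}))$ the algebra of pseudodifferential operators $A(\partial)=\sum_{n\le M}a_n\partial^n$, with symbol $A(z)=\sum_n a_nz^n$ and product $(A\circ B)(z)=A(z+\partial)B(z)$; put $A_+=\sum_{n\ge 0}a_n\partial^n$, $\operatorname{Res}_zA(z)=a_{-1}$ and $A^*(\partial)=\sum_n(-\partial)^n\circ a_n$. A $\lambda$-bracket on $\mathcal V$ is an $\mathbb F$-bilinear map $\{\cdot\,_\lambda\,\cdot\}:\mathcal V\times\mathcal V\to\mathcal V[\lambda]$ with $\{\partial a_\lambda b\}=-\lambda\{a_\lambda b\}$, $\{a_\lambda\partial b\}=(\lambda+\partial)\{a_\lambda b\}$, $\{a_\lambda bc\}=\{a_\lambda b\}c+\{a_\lambda c\}b$ and $\{ab_\lambda c\}=\{a_{\lambda+x}c\}(|_{x=\partial}b)+\{b_{\lambda+x}c\}(|_{x=\partial}a)$,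 where $p(\lambda+x)(|_{x=\partial}b)=\sum_np_n(\lambda+\partial)^nb$ for $p(\lambda)=\sum_n p_n\lambda^n$. It induces $\{\int f,g\}=\{f_\lambda g\}|_{\lambda=0}$ and $\{\int f,\int g\}=\int\{f_\lambda g\}|_{\lambda=0}$. It is a Poisson vertex algebra (PVA) $\lambda$-bracket on a differential subalgebra $\mathcal U$ if it maps $\mathcal U\times\mathcal U$ to $\mathcal U[\lambda]$ and satisfies on $\mathcal U$ skewsymmetry, $\{b_\lambda a\}=-\sum_n(-\lambda-\partial)^nc_n$ where $\{a_\lambda b\}=\sum_n c_n\lambda^n$, and the Jacobi identity $\{a_\lambda\{b_\mu c\}\}-\{b_\mu\{a_\lambda c\}\}=\{\{a_\lambda b\}_{\lambda+\mu}c\}$. A matrix $A\in\operatorname{Mat}_{N\times N}\mathcal V((\partial^{-1}))$ is of Adler type for a $\lambda$-bracket if for all $i,j,h,k$ $$\{A_{ij}(z)_\lambda A_{hk}(w)\}=A_{hj}(w+\lambda+\partial)\,\iota_z(z-w-\lambda-\partial)^{-1}(A_{ik})^*(\lambda-z)-A_{hj}(z)\,\iota_z(z-w-\lambda-\partial)^{-1}A_{ik}(w),$$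 where $\iota_z$ is the geometric expansion for large $z$. Given two $\lambda$-brackets $\{\cdot\,_\lambda\,\cdot\}_0$, $\{\cdot\,_\lambda\,\cdot\}_1$ on $\mathcal V$, $A$ is of bi-Adler type if for every $\epsilon\in\mathbb F$ the matrix $A+\epsilon\mathbb 1_N$ is of Adler type for $\{\cdot\,_\lambda\,\cdot\}_0+\epsilon\{\cdot\,_\lambda\,\cdot\}_1$. **Theorem.** Let $A\in\operatorname{Mat}_{N\times N}\mathcal V((\partial^{-1}))$ be invertible and of bi-Adler type with respect to $\{\cdot\,_\lambda\,\cdot\}_0$ and $\{\cdot\,_\lambda\,\cdot\}_1$. For a $K$-th root $B$ of $A$ ($B^K=A$, $K\in\mathbb Z\setminus\{0\}$) put $$h_{n,B}=-\frac Kn\operatorname{Res}_z\operatorname{tr}(B^n(z))\quad(n\in\mathbb Z\setminus\{0\}),\qquad h_{0,B}=0.$$ Let $\mathcal V_1\subset\mathcal V$ be the differential subalgebra generated by the coefficients of the entries of $A$. 1. For every $K$-th root $B$ of $A$ and every $n\in\mathbb Z$, $\{\int h_{n,B},A(z)\}_0=[(B^n)_+,A](z)$, and for $n\ne-K$ the generalized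 Lenard–Magri recurrence holds: $$\{\textstyle\int h_{n,B},A(z)\}_0=\{\textstyle\int h_{n+K,B},A(z)\}_1=[(B^n)_+,A](z).$$ 2. $\mathcal V_1$ is a bi-PVA: for every $\epsilon\in\mathbb F$, $\{\cdot\,_\lambda\,\cdot\}_0+\epsilon\{\cdot\,_\lambda\,\cdot\}_1$ is a PVA $\lambda$-bracket on $\mathcal V_1$. 3. The equations $\frac{du}{dt_{n,B}}=\{\int h_{n,B},u\}_0=\{\int h_{n+K,B},u\}_1$ are bi-Hamiltonian on $\mathcal V_1$: the second equality holds for every $K$-th root $B$, every $n\ne-K$ and every $u\in\mathcal V_1$. 4. For all roots $B,C$ of $A$ and all $m,n\in\mathbb Z$, $\{\int h_{m,B},\int h_{n,C}\}_0=\{\int h_{m,B},\int h_{n,C}\}_1=0$. Thus the Hamiltonian functionals are in involution for both brackets, and all of them are integrals of motion of all the equations. 5. The equations are compatible on $\mathcal V_1$: whenever $\int h_{m,B}$ and $\int h_{n,C}$ are local functionals of $\mathcal V_1$ (lie in the image $\int\mathcal V_1$), the maps $u\mapsto\{\int h_{m,B},u\}_i$ and $u\mapsto\{\int h_{n,C},u\}_i$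 ($i=0,1$) send $\mathcal V_1$ to itself and commute on $\mathcal V_1$. -/

import Mathlib

open Polynomial

section Calculus

open Finset.HasAntidiagonal (antidiagonal mem_antidiagonal)

variable {F : Type*} [Field F] {V : Type*} [CommRing V] [Algebra F V]

/-- The coefficient of `w ^ s` in the expansion
`(w + T) ^ q = ∑ r ≥ 0, binom(q, r) w ^ (q - r) T ^ r` in non-negative powers of `T`. -/
noncomputable def powCoeff {M : Type*} [AddCommGroup M] [Module F M] (T : Module.End F M)
    (q s : ℤ) : Module.End F M :=
  if s ≤ q then Ring.choose q (q - s).toNat • T ^ (q - s).toNat else 0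

theorem powCoeff_sub {M : Type*} [AddCommGroup M] [Module F M] (T : Module.End F M)
    (q s : ℤ) (j : ℕ) (h : s = q - j) :
    powCoeff T q s = Ring.choose q j • T ^ j := by
  subst h; simp [powCoeff]

theorem powCoeff_of_lt {M : Type*} [AddCommGroup M] [Module F M] (T : Module.End F M)
    (q s : ℤ) (h : q < s) : powCoeff T q s = 0 := by
  simp [powCoeff, not_le.2 h]

theorem derivation_pow_mul (D : Derivation F V V) (k : ℕ) (b c : V) :
    ((D : Module.End F V) ^ k) (b * c) =
      ∑ ij ∈ antidiagonal k,
        k.choose ij.1 • (((D : Module.End F V) ^ ij.1) b * ((D : Module.End F V) ^ ij.2) c) := by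
  induction k with
  | zero => simp
  | succ k ih =>
    rw [Finset.sum_antidiagonal_choose_succ_nsmul
      (fun i j => ((D : Module.End F V) ^ i) b * ((D : Module.End F V) ^ j) c),
      pow_succ', Module.End.mul_apply, ih, map_sum, ← Finset.sum_add_distrib]
    refine Finset.sum_congr rfl fun ij hij => ?_
    rw [← Nat.choose_symm_of_eq_add (mem_antidiagonal.mp hij).symm, ← smul_add,
      map_nsmul, pow_succ', pow_succ', Module.End.mul_apply, Module.End.mul_apply]
    congr 1
    simp only [Derivation.coeFn_coe, Derivation.leibniz, smul_eq_mul]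
    ring

theorem choose_assoc (m q : ℤ) (i l : ℕ) :
    ∑ jr ∈ antidiagonal l,
      (i + jr.1).choose i • (Ring.choose m (i + jr.1) * Ring.choose q jr.2) =
      Ring.choose m i * Ring.choose (m + q - i) l := by
  rw [show m + q - i = (m - i) + q by ring, Ring.add_choose_eq l (Commute.all _ _), Finset.mul_sum]
  refine Finset.sum_congr rfl fun jr _ => ?_
  rw [← smul_mul_assoc, Ring.choose_smul_choose m (Nat.le_add_right i jr.1)]
  simp [mul_assoc]

theorem powCoeff_assoc (D : Derivation F V V) (m q p n : ℤ) (b c : V) (J J' : Finset ℤ)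
    (h1 : ∀ s, n - p ≤ s → s ≤ m + q → s ∈ J) (h2 : ∀ r, n - m ≤ r → r ≤ p + q → r ∈ J') :
    ∑ s ∈ J, powCoeff (D : Module.End F V) m (s - q) b *
        powCoeff (D : Module.End F V) s (n - p) c =
      ∑ r ∈ J', powCoeff (D : Module.End F V) m (n - r)
        (b * powCoeff (D : Module.End F V) q (r - p) c) := by
  by_cases hk : m + q + p < n
  · rw [Finset.sum_eq_zero, Finset.sum_eq_zero]
    · intro r _
      by_cases h : m < n - r
      · simp [powCoeff_of_lt _ _ _ h]
      · rw [powCoeff_of_lt _ q (r - p) (by omega)]; simp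
    · intro s _
      by_cases h : m < s - q
      · simp [powCoeff_of_lt _ _ _ h]
      · rw [powCoeff_of_lt _ s (n - p) (by omega)]; simp
  obtain ⟨k, hk⟩ := Int.le.dest (not_lt.1 hk)
  have e1 : ∑ s ∈ J, powCoeff (D : Module.End F V) m (s - q) b *
        powCoeff (D : Module.End F V) s (n - p) c =
      ∑ ij ∈ antidiagonal k, (Ring.choose m ij.1 * Ring.choose (m + q - ij.1) ij.2) •
        (((D : Module.End F V) ^ ij.1) b * ((D : Module.End F V) ^ ij.2) c) := by
    symm
    refine Finset.sum_of_injOn (fun ij => m + q - (ij.1 : ℤ)) ?_ ?_ ?_ ?_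
    · rintro ⟨i, j⟩ hij ⟨i', j'⟩ hij' h
      simp only [Finset.mem_coe, mem_antidiagonal] at hij hij' h
      ext <;> simp only <;> omega
    · rintro ⟨i, j⟩ hij
      simp only [Finset.mem_coe, mem_antidiagonal] at hij
      exact h1 (m + q - (i : ℤ)) (by omega) (by omega)
    · intro s _ hs
      by_cases h : m < s - q
      · simp [powCoeff_of_lt _ _ _ h]
      · rw [powCoeff_of_lt _ s (n - p), LinearMap.zero_apply, mul_zero]
        by_contra h'
        apply hs
        refine ⟨((m + q - s).toNat, (s - (n - p)).toNat), ?_, ?_⟩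
        · simp only [Finset.mem_coe, mem_antidiagonal]; omega
        · simp only; omega
    · rintro ⟨i, j⟩ hij
      simp only [mem_antidiagonal] at hij
      rw [powCoeff_sub _ m _ i (by ring), powCoeff_sub _ (m + q - i) (n - p) j (by omega)]
      simp only [LinearMap.smul_apply, smul_mul_assoc, mul_smul_comm, mul_smul]
      rw [smul_comm]
  have e2 : ∑ r ∈ J', powCoeff (D : Module.End F V) m (n - r)
        (b * powCoeff (D : Module.End F V) q (r - p) c) =
      ∑ ij ∈ antidiagonal k, (Ring.choose m ij.1 * Ring.choose q ij.2) •
        (((D : Module.End F V) ^ ij.1) (b * ((D : Module.End F V) ^ ij.2) c)) := by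
    symm
    refine Finset.sum_of_injOn (fun ij => q + p - (ij.2 : ℤ)) ?_ ?_ ?_ ?_
    · rintro ⟨i, j⟩ hij ⟨i', j'⟩ hij' h
      simp only [Finset.mem_coe, mem_antidiagonal] at hij hij' h
      ext <;> simp only <;> omega
    · rintro ⟨i, j⟩ hij
      simp only [Finset.mem_coe, mem_antidiagonal] at hij
      exact h2 (q + p - (j : ℤ)) (by omega) (by omega)
    · intro r _ hs
      by_cases h : q < r - p
      · simp [powCoeff_of_lt _ _ _ h]
      · rw [powCoeff_of_lt _ m (n - r), LinearMap.zero_apply]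
        by_contra h'
        apply hs
        refine ⟨((m - (n - r)).toNat, (q + p - r).toNat), ?_, ?_⟩
        · simp only [Finset.mem_coe, mem_antidiagonal]; omega
        · simp only; omega
    · rintro ⟨i, j⟩ hij
      simp only [mem_antidiagonal] at hij
      rw [powCoeff_sub _ q _ j (by ring), powCoeff_sub _ m (n - _) i (by omega)]
      simp only [LinearMap.smul_apply, mul_smul_comm, mul_smul, map_zsmul]
      rw [smul_comm]
  rw [e1, e2]
  simp_rw [← choose_assoc, Finset.sum_smul, derivation_pow_mul, ← Module.End.mul_apply,
    ← pow_add, Finset.smul_sum, Finset.sum_sigma']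
  refine Finset.sum_nbij' (fun x => ⟨(x.1.1 + x.2.1, x.2.2), (x.1.1, x.2.1)⟩)
    (fun y => ⟨(y.2.1, y.2.2 + y.1.2), (y.2.2, y.1.2)⟩) ?_ ?_ ?_ ?_ ?_
  · rintro ⟨⟨i, l⟩, t, r⟩ h
    simp only [Finset.mem_sigma, mem_antidiagonal] at h ⊢
    exact ⟨by omega, trivial⟩
  · rintro ⟨⟨e, r⟩, i, t⟩ h
    simp only [Finset.mem_sigma, mem_antidiagonal] at h ⊢
    exact ⟨by omega, trivial⟩
  · rintro ⟨⟨i, l⟩, t, r⟩ h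
    simp only [Finset.mem_sigma, mem_antidiagonal] at h ⊢
    simp [h.2]
  · rintro ⟨⟨e, r⟩, i, t⟩ h
    simp only [Finset.mem_sigma, mem_antidiagonal] at h ⊢
    simp [h.2]
  · rintro ⟨⟨i, l⟩, t, r⟩ h
    simp only [Finset.mem_sigma, mem_antidiagonal] at h ⊢
    rw [h.2, ← Nat.cast_smul_eq_nsmul ℤ, ← Nat.cast_smul_eq_nsmul ℤ, smul_smul, smul_eq_mul,
      mul_comm]

end Calculus

/-! ### Pseudodifferential operators -/

/-- A scalar pseudodifferential operator `∑ n, a_n ∂ ^ n` over the differential algebra `(V, D)`: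
a two-sided sequence of coefficients with `a_n = 0` for `n` large, that is, an element of
`V((∂⁻¹))`. Its symbol is `∑ n, a_n z ^ n`, with the same coefficients. -/
@[ext]
structure PseudoDiffOp {F : Type*} [Field F] {V : Type*} [CommRing V] [Algebra F V]
    (D : Derivation F V V) where
  /-- `coeff n` is the coefficient of `∂ ^ n`. -/
  coeff : ℤ → V
  exists_bound : ∃ N : ℤ, ∀ n, N < n → coeff n = 0

namespace PseudoDiffOp

variable {F : Type*} [Field F] {V : Type*} [CommRing V] [Algebra F V] {D : Derivation F V V}

instance : Zero (PseudoDiffOp D) := ⟨⟨0, 0, fun _ _ => rfl⟩⟩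

instance : Add (PseudoDiffOp D) :=
  ⟨fun A B => ⟨A.coeff + B.coeff, by
    obtain ⟨M, hM⟩ := A.exists_bound
    obtain ⟨N, hN⟩ := B.exists_bound
    exact ⟨max M N, fun n hn => by
      simp [hM n ((le_max_left _ _).trans_lt hn), hN n ((le_max_right _ _).trans_lt hn)]⟩⟩⟩

instance : Neg (PseudoDiffOp D) :=
  ⟨fun A => ⟨-A.coeff, by
    obtain ⟨M, hM⟩ := A.exists_bound
    exact ⟨M, fun n hn => by simp [hM n hn]⟩⟩⟩

instance : Sub (PseudoDiffOp D) :=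
  ⟨fun A B => ⟨A.coeff - B.coeff, by
    obtain ⟨M, hM⟩ := A.exists_bound
    obtain ⟨N, hN⟩ := B.exists_bound
    exact ⟨max M N, fun n hn => by
      simp [hM n ((le_max_left _ _).trans_lt hn), hN n ((le_max_right _ _).trans_lt hn)]⟩⟩⟩

instance : SMul ℕ (PseudoDiffOp D) :=
  ⟨fun k A => ⟨k • A.coeff, by
    obtain ⟨M, hM⟩ := A.exists_bound
    exact ⟨M, fun n hn => by simp [hM n hn]⟩⟩⟩

instance : SMul ℤ (PseudoDiffOp D) :=
  ⟨fun k A => ⟨k • A.coeff, by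
    obtain ⟨M, hM⟩ := A.exists_bound
    exact ⟨M, fun n hn => by simp [hM n hn]⟩⟩⟩

theorem coeff_injective : Function.Injective (coeff : PseudoDiffOp D → ℤ → V) :=
  fun _ _ h => PseudoDiffOp.ext h

instance : AddCommGroup (PseudoDiffOp D) :=
  coeff_injective.addCommGroup coeff rfl (fun _ _ => rfl) (fun _ => rfl) (fun _ _ => rfl)
    (fun _ _ => rfl) (fun _ _ => rfl)

@[simp] theorem coeff_zero (n : ℤ) : (0 : PseudoDiffOp D).coeff n = 0 := rfl

@[simp] theorem coeff_add (A B : PseudoDiffOp D) (n : ℤ) :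
    (A + B).coeff n = A.coeff n + B.coeff n := rfl

/-- The summand of the coefficient of `∂ ^ n` in `A ∘ B` that comes from
`a_m ∂ ^ m ∘ b_q ∂ ^ q = a_m (∂ + D) ^ m (b_q) ∂ ^ q`. -/
noncomputable def mulTerm (A B : PseudoDiffOp D) (n : ℤ) (t : ℤ × ℤ) : V :=
  A.coeff t.1 * powCoeff (D : Module.End F V) t.1 (n - t.2) (B.coeff t.2)

theorem mulTerm_eq_zero (A B : PseudoDiffOp D) {M N : ℤ} (hM : ∀ n, M < n → A.coeff n = 0)
    (hN : ∀ n, N < n → B.coeff n = 0) (n : ℤ) (t : ℤ × ℤ)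
    (h : ¬ (t.1 ≤ M ∧ t.2 ≤ N ∧ n ≤ t.1 + t.2)) : mulTerm A B n t = 0 := by
  unfold mulTerm
  by_cases h1 : M < t.1
  · simp [hM _ h1]
  by_cases h2 : N < t.2
  · simp [hN _ h2]
  rw [powCoeff_of_lt _ _ _ (by omega)]
  simp

theorem mulTerm_finite (A B : PseudoDiffOp D) (n : ℤ) :
    (Function.support (mulTerm A B n)).Finite := by
  obtain ⟨M, hM⟩ := A.exists_bound
  obtain ⟨N, hN⟩ := B.exists_bound
  refine ((Finset.Icc (n - N) M ×ˢ Finset.Icc (n - M) N).finite_toSet).subset fun t ht => ?_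
  by_contra h
  refine ht (mulTerm_eq_zero A B hM hN n t fun h' => h ?_)
  simp only [Finset.coe_product, Set.mem_prod, Finset.coe_Icc, Set.mem_Icc]
  omega

/-- The product of pseudodifferential operators: `(A ∘ B)(z) = A(z + ∂) B(z)` on symbols,
expanded in non-negative powers of `∂`. -/
noncomputable instance : Mul (PseudoDiffOp D) :=
  ⟨fun A B => ⟨fun n => ∑ᶠ t : ℤ × ℤ, mulTerm A B n t, by
    obtain ⟨M, hM⟩ := A.exists_bound
    obtain ⟨N, hN⟩ := B.exists_bound
    refine ⟨M + N, fun n hn => ?_⟩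
    rw [finsum_congr (fun t => mulTerm_eq_zero A B hM hN n t (by omega)), finsum_zero]⟩⟩

/-- Multiplication by an element of `V`, as a pseudodifferential operator of order zero. -/
def const (D : Derivation F V V) (a : V) : PseudoDiffOp D :=
  ⟨fun n => if n = 0 then a else 0, 0, fun n hn => by simp [hn.ne']⟩

instance : One (PseudoDiffOp D) := ⟨const D 1⟩

theorem coeff_mul (A B : PseudoDiffOp D) (n : ℤ) :
    (A * B).coeff n = ∑ᶠ t : ℤ × ℤ, mulTerm A B n t := rfl

theorem coeff_one (n : ℤ) : (1 : PseudoDiffOp D).coeff n = if n = 0 then 1 else 0 := rfl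

theorem coeff_mul_eq_sum (A B : PseudoDiffOp D) {M N : ℤ} (hM : ∀ n, M < n → A.coeff n = 0)
    (hN : ∀ n, N < n → B.coeff n = 0) (n : ℤ) (I J : Finset ℤ)
    (hI : ∀ m, n - N ≤ m → m ≤ M → m ∈ I) (hJ : ∀ q, n - M ≤ q → q ≤ N → q ∈ J) :
    (A * B).coeff n = ∑ m ∈ I, ∑ q ∈ J,
      A.coeff m * powCoeff (D : Module.End F V) m (n - q) (B.coeff q) := by
  rw [coeff_mul, finsum_eq_sum_of_support_subset (s := I ×ˢ J), Finset.sum_product]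
  · rfl
  · intro t ht
    by_contra h
    refine ht (mulTerm_eq_zero A B hM hN n t fun h' => h ?_)
    simp only [Finset.coe_product, Set.mem_prod, Finset.mem_coe]
    exact ⟨hI _ (by omega) (by omega), hJ _ (by omega) (by omega)⟩

protected theorem mul_assoc (A B C : PseudoDiffOp D) : A * B * C = A * (B * C) := by
  obtain ⟨M, hM⟩ := A.exists_bound
  obtain ⟨N, hN⟩ := B.exists_bound
  obtain ⟨P, hP⟩ := C.exists_bound
  have hMN : ∀ n, M + N < n → (A * B).coeff n = 0 := fun n hn => by
    rw [coeff_mul, finsum_congr (fun t => mulTerm_eq_zero A B hM hN n t (by omega)), finsum_zero]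
  have hNP : ∀ n, N + P < n → (B * C).coeff n = 0 := fun n hn => by
    rw [coeff_mul, finsum_congr (fun t => mulTerm_eq_zero B C hN hP n t (by omega)), finsum_zero]
  ext n
  rw [coeff_mul_eq_sum (A * B) C hMN hP n (Finset.Icc (n - P) (M + N)) (Finset.Icc (n - M - N) P)
      (fun s _ _ => Finset.mem_Icc.2 (by omega)) (fun s _ _ => Finset.mem_Icc.2 (by omega)),
    coeff_mul_eq_sum A (B * C) hM hNP n (Finset.Icc (n - N - P) M) (Finset.Icc (n - M) (N + P))
      (fun s _ _ => Finset.mem_Icc.2 (by omega)) (fun s _ _ => Finset.mem_Icc.2 (by omega))]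
  have eL : ∀ s ∈ Finset.Icc (n - P) (M + N), (A * B).coeff s =
      ∑ m ∈ Finset.Icc (n - N - P) M, ∑ q ∈ Finset.Icc (n - M - P) N,
        A.coeff m * powCoeff (D : Module.End F V) m (s - q) (B.coeff q) := fun s hs => by
    rw [Finset.mem_Icc] at hs
    exact coeff_mul_eq_sum A B hM hN s _ _ (fun s _ _ => Finset.mem_Icc.2 (by omega))
      (fun s _ _ => Finset.mem_Icc.2 (by omega))
  have eR : ∀ r ∈ Finset.Icc (n - M) (N + P), (B * C).coeff r =
      ∑ q ∈ Finset.Icc (n - M - P) N, ∑ p ∈ Finset.Icc (n - M - N) P,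
        B.coeff q * powCoeff (D : Module.End F V) q (r - p) (C.coeff p) := fun r hr => by
    rw [Finset.mem_Icc] at hr
    exact coeff_mul_eq_sum B C hN hP r _ _ (fun s _ _ => Finset.mem_Icc.2 (by omega))
      (fun s _ _ => Finset.mem_Icc.2 (by omega))
  have key : ∀ m ∈ Finset.Icc (n - N - P) M, ∀ q ∈ Finset.Icc (n - M - P) N,
      ∀ p ∈ Finset.Icc (n - M - N) P,
      ∑ s ∈ Finset.Icc (n - P) (M + N), powCoeff (D : Module.End F V) m (s - q) (B.coeff q) *
          powCoeff (D : Module.End F V) s (n - p) (C.coeff p) =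
        ∑ r ∈ Finset.Icc (n - M) (N + P), powCoeff (D : Module.End F V) m (n - r)
          (B.coeff q * powCoeff (D : Module.End F V) q (r - p) (C.coeff p)) := by
    intro m hm q hq p hp
    rw [Finset.mem_Icc] at hm hq hp
    exact powCoeff_assoc D m q p n _ _ _ _ (fun s _ _ => Finset.mem_Icc.2 (by omega))
      (fun s _ _ => Finset.mem_Icc.2 (by omega))
  calc
    _ = ∑ s ∈ Finset.Icc (n - P) (M + N), ∑ p ∈ Finset.Icc (n - M - N) P,
        ∑ m ∈ Finset.Icc (n - N - P) M, ∑ q ∈ Finset.Icc (n - M - P) N,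
          A.coeff m * (powCoeff (D : Module.End F V) m (s - q) (B.coeff q) *
            powCoeff (D : Module.End F V) s (n - p) (C.coeff p)) := by
      refine Finset.sum_congr rfl fun s hs => Finset.sum_congr rfl fun p _ => ?_
      simp only [eL s hs, Finset.sum_mul, mul_assoc]
    _ = ∑ m ∈ Finset.Icc (n - N - P) M, ∑ q ∈ Finset.Icc (n - M - P) N,
        ∑ p ∈ Finset.Icc (n - M - N) P, A.coeff m * ∑ s ∈ Finset.Icc (n - P) (M + N),
          (powCoeff (D : Module.End F V) m (s - q) (B.coeff q) *
            powCoeff (D : Module.End F V) s (n - p) (C.coeff p)) := by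
      simp only [Finset.mul_sum]
      rw [Finset.sum_comm]
      simp_rw [Finset.sum_comm (s := Finset.Icc (n - P) (M + N))]
      rw [Finset.sum_comm]
      exact Finset.sum_congr rfl fun m _ => Finset.sum_comm
    _ = ∑ m ∈ Finset.Icc (n - N - P) M, ∑ q ∈ Finset.Icc (n - M - P) N,
        ∑ p ∈ Finset.Icc (n - M - N) P, A.coeff m * ∑ r ∈ Finset.Icc (n - M) (N + P),
          powCoeff (D : Module.End F V) m (n - r)
            (B.coeff q * powCoeff (D : Module.End F V) q (r - p) (C.coeff p)) :=
      Finset.sum_congr rfl fun m hm => Finset.sum_congr rfl fun q hq =>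
        Finset.sum_congr rfl fun p hp => by rw [key m hm q hq p hp]
    _ = _ := by
      refine Finset.sum_congr rfl fun m _ => ?_
      simp only [Finset.mul_sum]
      simp_rw [Finset.sum_comm (t := Finset.Icc (n - M) (N + P))]
      refine Finset.sum_congr rfl fun r hr => ?_
      simp only [eR r hr, map_sum, Finset.mul_sum]

protected theorem add_mul (A B C : PseudoDiffOp D) : (A + B) * C = A * C + B * C := by
  ext n
  rw [coeff_add, coeff_mul, coeff_mul, coeff_mul,
    ← finsum_add_distrib (mulTerm_finite A C n) (mulTerm_finite B C n)]
  exact finsum_congr fun t => by simp [mulTerm, add_mul]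

protected theorem mul_add (A B C : PseudoDiffOp D) : A * (B + C) = A * B + A * C := by
  ext n
  rw [coeff_add, coeff_mul, coeff_mul, coeff_mul,
    ← finsum_add_distrib (mulTerm_finite A B n) (mulTerm_finite A C n)]
  exact finsum_congr fun t => by simp [mulTerm, mul_add]

protected theorem one_mul (A : PseudoDiffOp D) : 1 * A = A := by
  ext n
  rw [coeff_mul, finsum_eq_single _ ((0 : ℤ), n)]
  · simp [mulTerm, coeff_one, powCoeff]
  · rintro ⟨m, q⟩ h
    by_cases hm : m = 0
    · subst hm
      have hq : q ≠ n := fun e => h (by rw [e])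
      by_cases hlt : 0 < n - q
      · simp [mulTerm, powCoeff_of_lt _ _ _ hlt]
      · obtain ⟨k, hk⟩ : ∃ k : ℕ, q - n = k + 1 := ⟨(q - n - 1).toNat, by omega⟩
        simp [mulTerm, powCoeff_sub _ 0 (n - q) (k + 1) (by push_cast; omega),
          Ring.choose_zero_succ]
    · simp [mulTerm, coeff_one, hm]

protected theorem mul_one (A : PseudoDiffOp D) : A * 1 = A := by
  ext n
  rw [coeff_mul, finsum_eq_single _ (n, (0 : ℤ))]
  · simp [mulTerm, coeff_one, powCoeff]
  · rintro ⟨m, q⟩ h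
    by_cases hq : q = 0
    · subst hq
      have hm : m ≠ n := fun e => h (by rw [e])
      by_cases hlt : m < n
      · simp [mulTerm, powCoeff_of_lt _ _ _ hlt]
      · obtain ⟨k, hk⟩ : ∃ k : ℕ, m - n = k + 1 := ⟨(m - n - 1).toNat, by omega⟩
        simp [mulTerm, powCoeff_sub _ m n (k + 1) (by push_cast; omega),
          coeff_one, pow_succ]
    · simp [mulTerm, coeff_one, hq]

/-- The associative algebra `V((∂⁻¹))`, as a ring. -/
noncomputable instance : Ring (PseudoDiffOp D) :=
  { (inferInstance : AddCommGroup (PseudoDiffOp D)) with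
    mul := (· * ·)
    one := 1
    mul_assoc := PseudoDiffOp.mul_assoc
    one_mul := PseudoDiffOp.one_mul
    mul_one := PseudoDiffOp.mul_one
    left_distrib := PseudoDiffOp.mul_add
    right_distrib := PseudoDiffOp.add_mul
    zero_mul := fun A => by
      have h := PseudoDiffOp.add_mul (0 : PseudoDiffOp D) 0 A
      rw [add_zero] at h
      exact left_eq_add.1 h
    mul_zero := fun A => by
      have h := PseudoDiffOp.mul_add A (0 : PseudoDiffOp D) 0
      rw [add_zero] at h
      exact left_eq_add.1 h }

/-- The differential part `A_+ = ∑ n ≥ 0, a_n ∂ ^ n`. -/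
def pos (A : PseudoDiffOp D) : PseudoDiffOp D :=
  ⟨fun n => if 0 ≤ n then A.coeff n else 0, by
    obtain ⟨M, hM⟩ := A.exists_bound
    exact ⟨M, fun n hn => by simp [hM n hn]⟩⟩

end PseudoDiffOp

/-! ### Lambda-brackets -/

section LambdaBracket

variable {F : Type*} [Field F] {V : Type*} [CommRing V] [Algebra F V]

/-- The operator `λ + ∂` on `V[λ]`: the variable `λ` is `X`, and `∂` acts on coefficients. -/
noncomputable def lambdaAdd (D : Derivation F V V) : Module.End F V[X] :=
  LinearMap.mulLeft F (X : V[X]) +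
    (PolynomialModule.equivPolynomialSelf.compDer D.mapCoeffs : Derivation F V[X] V[X])

theorem coeff_lambdaAdd (D : Derivation F V V) (p : V[X]) (n : ℕ) :
    (lambdaAdd D p).coeff n = (X * p).coeff n + D (p.coeff n) := rfl

/-- `p(λ + x) (|_{x = ∂} b) = ∑ n, p_n (λ + ∂) ^ n b` for `p = ∑ n, p_n λ ^ n` in `V[λ]`. -/
noncomputable def shiftApply (D : Derivation F V V) (p : V[X]) (b : V) : V[X] :=
  p.sum fun n c => C c * (lambdaAdd D ^ n) (C b)

/-- `(|_{x = ∂} p(-λ - x)) = ∑ n, (-λ - ∂) ^ n p_n` for `p = ∑ n, p_n λ ^ n` in `V[λ]`. -/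
noncomputable def negShift (D : Derivation F V V) (p : V[X]) : V[X] :=
  p.sum fun n c => ((-lambdaAdd D) ^ n) (C c)

theorem shiftApply_add (D : Derivation F V V) (p q : V[X]) (b : V) :
    shiftApply D (p + q) b = shiftApply D p b + shiftApply D q b :=
  sum_add_index p q _ (fun _ => by simp) (fun _ _ _ => by rw [C_add, add_mul])

theorem shiftApply_smul (D : Derivation F V V) (e : F) (p : V[X]) (b : V) :
    shiftApply D (e • p) b = e • shiftApply D p b := by
  rw [← algebraMap_smul V e p, shiftApply, sum_smul_index p _ _ (fun _ => by simp), shiftApply,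
    Polynomial.sum, Polynomial.sum, Finset.smul_sum]
  refine Finset.sum_congr rfl fun n _ => ?_
  rw [C_mul, mul_assoc, ← smul_eq_C_mul, algebraMap_smul]

/-- A `λ`-bracket on the differential algebra `(V, D)` over `F`: an `F`-bilinear map
`{a_λ b}` with values in `V[λ]`, satisfying sesquilinearity and the Leibniz rules.
Neither skewsymmetry nor the Jacobi identity is required. -/
structure LambdaBracket (D : Derivation F V V) where
  /-- `br a b` is `{a_λ b}`. -/
  br : V →ₗ[F] V →ₗ[F] V[X]
  sesq_left : ∀ a b, br (D a) b = -(X * br a b)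
  sesq_right : ∀ a b, br a (D b) = lambdaAdd D (br a b)
  leibniz_right : ∀ a b c, br a (b * c) = C c * br a b + C b * br a c
  leibniz_left : ∀ a b c, br (a * b) c = shiftApply D (br a c) b + shiftApply D (br b c) a

namespace LambdaBracket

variable {D : Derivation F V V}

/-- The pencil `{· _λ ·}_ε = {· _λ ·}_0 + ε {· _λ ·}_1`. -/
noncomputable def pencil (L₀ L₁ : LambdaBracket D) (ε : F) : LambdaBracket D where
  br := L₀.br + ε • L₁.br
  sesq_left a b := by
    simp only [LinearMap.add_apply, LinearMap.smul_apply, sesq_left, mul_add, mul_smul_comm,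
      smul_neg, neg_add]
  sesq_right a b := by
    simp only [LinearMap.add_apply, LinearMap.smul_apply, sesq_right, map_add, map_smul]
  leibniz_right a b c := by
    simp only [LinearMap.add_apply, LinearMap.smul_apply, leibniz_right, mul_add, mul_smul_comm,
      smul_add]
    abel
  leibniz_left a b c := by
    simp only [LinearMap.add_apply, LinearMap.smul_apply, leibniz_left, shiftApply_add,
      shiftApply_smul, smul_add]
    abel

end LambdaBracket

/-- The space `V / ∂V` of local functionals. -/
abbrev LocalFunctional (D : Derivation F V V) : Type _ := V ⧸ LinearMap.range (D : V →ₗ[F] V)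

/-- The quotient map `∫ : V → V / ∂V`. -/
def integralMap (D : Derivation F V V) : V →ₗ[F] LocalFunctional D :=
  (LinearMap.range (D : V →ₗ[F] V)).mkQ

namespace LambdaBracket

variable {D : Derivation F V V}

/-- The action `{∫f, g} = {f_λ g}|_{λ = 0}` of `V / ∂V` on `V`. -/
noncomputable def action (L : LambdaBracket D) : LocalFunctional D →ₗ[F] V →ₗ[F] V :=
  (LinearMap.range (D : V →ₗ[F] V)).liftQ
    (L.br.compr₂ ((lcoeff V 0).restrictScalars F)) (by
      rintro _ ⟨a, rfl⟩
      rw [LinearMap.mem_ker]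
      ext b
      simp [L.sesq_left])

@[simp] theorem action_integral (L : LambdaBracket D) (f g : V) :
    L.action (integralMap D f) g = (L.br f g).coeff 0 := rfl

/-- The bracket `{∫f, ∫g} = ∫{f_λ g}|_{λ = 0}` on `V / ∂V`. -/
noncomputable def functionalBracket (L : LambdaBracket D) (f : LocalFunctional D) :
    LocalFunctional D →ₗ[F] LocalFunctional D :=
  Submodule.mapQ _ _ (L.action f) (by
    rintro _ ⟨b, rfl⟩
    obtain ⟨a, rfl⟩ := Submodule.mkQ_surjective _ f
    refine ⟨(L.br a b).coeff 0, ?_⟩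
    change D ((L.br a b).coeff 0) = (L.br a (D b)).coeff 0
    rw [L.sesq_right, coeff_lambdaAdd]
    simp)

@[simp] theorem functionalBracket_integral (L : LambdaBracket D) (f g : V) :
    L.functionalBracket (integralMap D f) (integralMap D g) = integralMap D ((L.br f g).coeff 0) := rfl

/-- The subalgebra `S` of `V` (stable under `∂` in the applications) is a Poisson vertex algebra
with the restriction of the `λ`-bracket: the bracket of two elements of `S` lies in `S[λ]`, and
skewsymmetry and the Jacobi identity hold on `S`. The Jacobi identity
`{a_λ {b_μ c}} - {b_μ {a_λ c}} = {{a_λ b}_{λ+μ} c}` is written in `V[λ][μ]`. -/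
structure IsPVAOn (L : LambdaBracket D) (S : Subalgebra F V) : Prop where
  closed : ∀ a ∈ S, ∀ b ∈ S, ∀ n, (L.br a b).coeff n ∈ S
  skew : ∀ a ∈ S, ∀ b ∈ S, L.br b a = -negShift D (L.br a b)
  jacobi : ∀ a ∈ S, ∀ b ∈ S, ∀ c ∈ S,
    ((L.br b c).sum fun n r => C (L.br a r) * (X : V[X][X]) ^ n) -
      ((L.br a c).sum fun n r => (L.br b r).map C * C (X ^ n)) =
    (L.br a b).sum fun n r => C (X ^ n) * (L.br r c).eval₂ (C.comp C) (C X + X)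

/-- `S` is a bi-Poisson vertex algebra: every member of the pencil makes it a PVA. -/
def IsBiPVAOn (L₀ L₁ : LambdaBracket D) (S : Subalgebra F V) : Prop :=
  ∀ ε : F, (pencil L₀ L₁ ε).IsPVAOn S

end LambdaBracket

/-! ### Operators of Adler type -/

variable {D : Derivation F V V}

/-- For scalar symbols `P(z) = ∑ b_q z ^ q` and `Q(z) = ∑ a_p z ^ p`, the coefficient of
`z ^ m w ^ n` in
`P(w + λ + ∂) ι_z (z - w - λ - ∂)⁻¹ Q^*(λ - z) - P(z) ι_z (z - w - λ - ∂)⁻¹ Q(w)`.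
Here `ι_z (z - w - λ - ∂)⁻¹ = ∑ k ≥ 0, z ^ (-k - 1) (w + λ + ∂) ^ k` and
`Q^*(λ - z) = ∑ p, (z - λ - ∂) ^ p a_p` (expanded for large `z`), so that the two terms are
`∑ k p q, b_q z ^ (-k - 1) (w + λ + ∂) ^ (q + k) (z - λ - ∂) ^ p a_p` and
`∑ k p q, b_q z ^ (q - k - 1) (w + λ + ∂) ^ k a_p w ^ p`. Both sums have finitely many non-zero
contributions to each coefficient. -/
noncomputable def adlerCoeff (P Q : PseudoDiffOp D) (m n : ℤ) : V[X] :=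
  (∑ᶠ t : ℕ × ℤ × ℤ, C (P.coeff t.2.2) *
    powCoeff (lambdaAdd D) (t.2.2 + t.1) n
      (powCoeff (-lambdaAdd D) t.2.1 (m + t.1 + 1) (C (Q.coeff t.2.1)))) -
  ∑ᶠ t : ℕ × ℤ, C (P.coeff (m + t.1 + 1)) *
    powCoeff (lambdaAdd D) t.1 (n - t.2) (C (Q.coeff t.2))

/-- The matrix pseudodifferential operator `A` is of Adler type with respect to the `λ`-bracket:
the Adler identity for `{A_{ij}(z)_λ A_{hk}(w)}`, compared at every `z ^ m w ^ n`. -/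
def IsAdlerType (L : LambdaBracket D) {M N : ℕ}
    (A : Matrix (Fin M) (Fin N) (PseudoDiffOp D)) : Prop :=
  ∀ (i : Fin M) (j : Fin N) (h : Fin M) (k : Fin N) (m n : ℤ),
    L.br ((A i j).coeff m) ((A h k).coeff n) = adlerCoeff (A h j) (A i k) m n

/-- `A` is of bi-Adler type: for every `ε` in `F` the operator `A + ε 1_N` is of Adler type with
respect to `{· _λ ·}_0 + ε {· _λ ·}_1`. -/
def IsBiAdlerType (L₀ L₁ : LambdaBracket D) {N : ℕ}
    (A : Matrix (Fin N) (Fin N) (PseudoDiffOp D)) : Prop :=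
  ∀ ε : F, IsAdlerType (L₀.pencil L₁ ε)
    (A + Matrix.diagonal fun _ => PseudoDiffOp.const D (algebraMap F V ε))

/-- The differential subalgebra of `V` generated by the coefficients of the entries of `A`. -/
def coeffSubalgebra {N : ℕ} (A : Matrix (Fin N) (Fin N) (PseudoDiffOp D)) : Subalgebra F V :=
  Algebra.adjoin F {v | ∃ i j m, ∃ r : ℕ, v = D^[r] ((A i j).coeff m)}

/-- `B` is a `K`-th root of the invertible matrix operator `A`, where `K` is a non-zero integer.
Every matrix `B` with `B ^ K = A` is itself invertible, so `B` is taken among the units. -/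
def IsOperatorRoot {N : ℕ} (A B : (Matrix (Fin N) (Fin N) (PseudoDiffOp D))ˣ) (K : ℤ) : Prop :=
  K ≠ 0 ∧ B ^ K = A

/-- `h_{n,B} = -(K / n) Res_z tr (B ^ n)(z)` for `n ≠ 0`, and `h_{0,B} = 0`. -/
noncomputable def hDensity {N : ℕ} (K : ℤ) (B : (Matrix (Fin N) (Fin N) (PseudoDiffOp D))ˣ)
    (n : ℤ) : V :=
  if n = 0 then 0
  else (-(K : F) / (n : F)) •
    (Matrix.trace ((B ^ n : (Matrix (Fin N) (Fin N) (PseudoDiffOp D))ˣ) :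
      Matrix (Fin N) (Fin N) (PseudoDiffOp D))).coeff (-1)

/-- The commutator `[(B ^ n)_+, A]`. -/
noncomputable def laxCommutator {N : ℕ} (A B : (Matrix (Fin N) (Fin N) (PseudoDiffOp D))ˣ)
    (n : ℤ) : Matrix (Fin N) (Fin N) (PseudoDiffOp D) :=
  ⁅((B ^ n : (Matrix (Fin N) (Fin N) (PseudoDiffOp D))ˣ) :
      Matrix (Fin N) (Fin N) (PseudoDiffOp D)).map PseudoDiffOp.pos,
    (A : Matrix (Fin N) (Fin N) (PseudoDiffOp D))⁆

end LambdaBracket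

/-! The Adler identity describes vector fields. Let `λ` act as `∂` on a test function `f`, and let
`a` be the coefficient of `z ^ m` in `A_ij`. Then `v ↦ {a_∂ v} f` sends `A` to the Adler map `A (x
A)_+ - (A x)_+ A`, where `x` is `∂ ^ (-1 - m) ∘ f` placed at position `(j, i)`
(`jetEval_adlerCoeff`, `matrixDer_hamDer_of_isAdlerType`). The test functions are three differential
indeterminates adjoined to `V`: an operator is determined by its value on an indeterminate, and that
value by its integral against a further one (`eq_zero_of_integral_X_mul`).

For the coefficients of `A`, skewsymmetry and the Jacobi identity thus become algebra in a ring
split into two subrings, each isotropic for the trace `∫ Res tr`: see `tr_adler_skew` and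
`adlerTriple_cyclic`. They spread to `V_1` because both sides are, in one argument, derivations
commuting with `∂`, and because the integrated Jacobi identity is cyclic. Applied to `A + ε`, this
gives the bi-PVA.

For the recurrence, cyclicity of the trace gives `K tr δ(B ^ n) = n tr (B ^ (n - K) δA)`. So `-B ^
(n - K)`, which commutes with `A`, is the gradient of `∫h_{n,B}`. Pairing such a `g` with the Adler
map of `A` yields `[(g A)_+, A]` (`tr_mul_adler`); pairing it with the part of the Adler map of `A +
ε` linear in `ε` yields `[g_+, A]` (`tr_mul_adler_one`). The first with `h_n` and the second with
`h_{n+K}` both give `[(B ^ n)_+, A]`.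

Every flow is therefore a Lax equation, and `tr (C ^ (n - K) [P, A]) = 0` because `C` commutes with
`A`: this is involution. The Jacobi identity at `λ = μ = 0` turns involution into commuting flows.
-/

/-! ### Binomial identities for expanded powers. -/

section PowCoeff

variable {F : Type*} [Field F]

theorem map_powCoeff {M M' : Type*} [AddCommGroup M] [Module F M] [AddCommGroup M'] [Module F M']
    (f : M →ₗ[F] M') (T : Module.End F M) (T' : Module.End F M') (h : ∀ x, f (T x) = T' (f x))
    (q s : ℤ) (x : M) : f (powCoeff T q s x) = powCoeff T' q s (f x) := by
  have hpow : ∀ (n : ℕ) (x : M), f ((T ^ n) x) = (T' ^ n) (f x) := by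
    intro n
    induction n with
    | zero => simp
    | succ n ih => intro x; rw [pow_succ, pow_succ, Module.End.mul_apply, ih, h]; rfl
  unfold powCoeff
  split_ifs
  · simp [hpow]
  · simp

/-- Chu–Vandermonde in the form needed for the positive part of `∂ ^ (-1 - m) ∘ h ∂ ^ p`. -/
theorem powCoeff_neg_one_sub {M : Type*} [AddCommGroup M] [Module F M] (T : Module.End F M)
    (m p r : ℤ) (hr : 0 ≤ r) (K : ℕ) (hK : p - m ≤ K) (x : M) :
    powCoeff T (-1 - m) (r - p) x =
      ∑ k ∈ Finset.range K, powCoeff T k r (powCoeff (-T) p (m + k + 1) x) := by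
  obtain ⟨r, rfl⟩ := Int.eq_ofNat_of_zero_le hr
  by_cases hs : -1 - m < r - p
  · rw [powCoeff_of_lt _ _ _ hs, Finset.sum_eq_zero]
    · simp
    · intro k _
      by_cases hk : (k : ℤ) < r
      · simp [powCoeff_of_lt _ _ _ hk]
      · rw [powCoeff_of_lt (-T) p _ (by omega)]; simp
  obtain ⟨s, hs⟩ := Int.le.dest (not_lt.1 hs)
  rw [powCoeff_sub T (-1 - m) (r - p) s (by omega)]
  -- Negating the upper index turns `-1 - m` into `m + s = -(r + 1) + p`; Vandermonde splits this
  -- sum, and a second negation turns the `-(r + 1)` part into `r + i`.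
  have hc : Ring.choose (-1 - m) s = ∑ ij ∈ Finset.HasAntidiagonal.antidiagonal s,
      Ring.choose ((r : ℤ) + ij.1) ij.1 * ((-1) ^ ij.2 * Ring.choose p ij.2) := by
    have h1 : Ring.choose (-1 - m) s = (-1) ^ s * Ring.choose (-(r + 1 : ℤ) + p) s := by
      have := Ring.choose_neg (R := ℤ) (1 + m) s
      rw [show -1 - m = -(1 + m) by ring, this,
        show (1 + m + s - 1 : ℤ) = -(r + 1 : ℤ) + p by omega]
      simp [Int.negOnePow, Units.smul_def]
    rw [h1, Ring.add_choose_eq s (Commute.all _ _), Finset.mul_sum]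
    refine Finset.sum_congr rfl fun ij hij => ?_
    rw [Ring.choose_neg, ← Finset.HasAntidiagonal.mem_antidiagonal.1 hij, pow_add,
      show (r + 1 + ij.1 - 1 : ℤ) = r + ij.1 by ring]
    simp only [Int.negOnePow, Units.smul_def, zpow_natCast, Units.val_pow_eq_pow_val,
      Units.val_neg, Units.val_one, smul_eq_mul]
    have : ((-1 : ℤ) ^ ij.1) * (-1) ^ ij.1 = 1 := by rw [← mul_pow]; simp
    linear_combination (-1) ^ ij.2 * Ring.choose ((r : ℤ) + ij.1) ij.1 * Ring.choose p ij.2 * this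
  rw [hc, Finset.sum_smul, LinearMap.sum_apply]
  -- Only `k = r + i` with `i + j = s` contributes: the outer factor vanishes for `k < r`, the inner
  -- one for `k > r + s`.
  refine Finset.sum_of_injOn (fun ij => r + ij.1) ?_ ?_ ?_ ?_
  · rintro ⟨i, j⟩ hij ⟨i', j'⟩ hij' h
    simp only [Finset.mem_coe, Finset.HasAntidiagonal.mem_antidiagonal] at hij hij' h
    ext <;> simp only <;> omega
  · rintro ⟨i, j⟩ hij
    simp only [Finset.mem_coe, Finset.HasAntidiagonal.mem_antidiagonal, Finset.mem_range] at hij ⊢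
    omega
  · intro k _ hk
    by_cases hkr : (k : ℤ) < r
    · simp [powCoeff_of_lt _ _ _ hkr]
    · rw [powCoeff_of_lt (-T) p, LinearMap.zero_apply, map_zero]
      by_contra h'
      apply hk
      refine ⟨(k - r, s - (k - r)), ?_, ?_⟩
      · simp only [Finset.mem_coe, Finset.HasAntidiagonal.mem_antidiagonal]; omega
      · simp only; omega
  · rintro ⟨i, j⟩ hij
    simp only [Finset.HasAntidiagonal.mem_antidiagonal] at hij
    rw [powCoeff_sub T _ r i (by push_cast; ring), powCoeff_sub (-T) p _ j (by push_cast; omega)]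
    have hneg : (-T) ^ j = ((-1 : ℤ) ^ j) • T ^ j := by
      rw [neg_pow]; rcases neg_one_pow_eq_or ℤ j with h | h <;>
      rcases Nat.even_or_odd j with h' | h' <;> simp [h'.neg_one_pow]
    simp only [LinearMap.smul_apply, hneg, map_zsmul, ← Module.End.mul_apply, ← pow_add, hij,
      smul_smul]
    push_cast
    congr 1
    ring

end PowCoeff

/-! ### Products with powers of `∂` and with functions; differential part, functoriality, residue.
-/

namespace PseudoDiffOp

variable {F : Type*} [Field F] {V : Type*} [CommRing V] [Algebra F V] {D : Derivation F V V}

@[simp] theorem coeff_neg (A : PseudoDiffOp D) (n : ℤ) : (-A).coeff n = -A.coeff n := rfl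

@[simp] theorem coeff_sub (A B : PseudoDiffOp D) (n : ℤ) :
    (A - B).coeff n = A.coeff n - B.coeff n := rfl

/-- Taking the coefficient of `∂ ^ n`, as an additive map. -/
def coeffHom (D : Derivation F V V) (n : ℤ) : PseudoDiffOp D →+ V where
  toFun A := A.coeff n
  map_zero' := rfl
  map_add' _ _ := rfl

@[simp] theorem coeff_sum {ι : Type*} (s : Finset ι) (f : ι → PseudoDiffOp D) (n : ℤ) :
    (∑ i ∈ s, f i).coeff n = ∑ i ∈ s, (f i).coeff n :=
  map_sum (coeffHom D n) f s

@[simp] theorem coeff_const (a : V) (n : ℤ) : (const D a).coeff n = if n = 0 then a else 0 := rfl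

/-- The operator `∂ ^ n`. -/
def dpow (D : Derivation F V V) (n : ℤ) : PseudoDiffOp D :=
  ⟨fun m => if m = n then 1 else 0, n, fun m hm => by simp [hm.ne']⟩

@[simp] theorem coeff_dpow (m n : ℤ) : (dpow D m).coeff n = if n = m then 1 else 0 := rfl

theorem powCoeff_one (q s : ℤ) : powCoeff (D : Module.End F V) q s 1 = if s = q then 1 else 0 := by
  split_ifs with h
  · subst h; simp [powCoeff]
  · by_cases hlt : q < s
    · simp [powCoeff_of_lt _ _ _ hlt]
    · obtain ⟨k, hk⟩ : ∃ k : ℕ, q - s = k + 1 := ⟨(q - s - 1).toNat, by omega⟩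
      simp [powCoeff_sub _ q s (k + 1) (by push_cast; omega), pow_succ]

theorem powCoeff_zero_left {M : Type*} [AddCommGroup M] [Module F M] (T : Module.End F M) (s : ℤ)
    (x : M) : powCoeff T 0 s x = if s = 0 then x else 0 := by
  split_ifs with h
  · subst h; simp [powCoeff]
  · by_cases hlt : 0 < s
    · simp [powCoeff_of_lt _ _ _ hlt]
    · obtain ⟨k, hk⟩ : ∃ k : ℕ, 0 - s = k + 1 := ⟨(0 - s - 1).toNat, by omega⟩
      simp [powCoeff_sub _ 0 s (k + 1) (by push_cast; omega), Ring.choose_zero_succ]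

theorem coeff_mul_dpow (A : PseudoDiffOp D) (m n : ℤ) :
    (A * dpow D m).coeff n = A.coeff (n - m) := by
  rw [coeff_mul, finsum_eq_single _ (n - m, m)]
  · simp [mulTerm, powCoeff_one]
  · rintro ⟨p, q⟩ h
    by_cases hq : q = m
    · subst hq
      have : n - q ≠ p := fun e => h (by rw [e])
      simp [mulTerm, powCoeff_one, this]
    · simp [mulTerm, hq]

theorem coeff_const_mul (a : V) (A : PseudoDiffOp D) (n : ℤ) :
    (const D a * A).coeff n = a * A.coeff n := by
  rw [coeff_mul, finsum_eq_single _ ((0 : ℤ), n)]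
  · simp [mulTerm, powCoeff_zero_left]
  · rintro ⟨p, q⟩ h
    by_cases hp : p = 0
    · subst hp
      have : n - q ≠ 0 := fun e => h (by rw [sub_eq_zero.1 e])
      simp [mulTerm, powCoeff_zero_left, this]
    · simp [mulTerm, hp]

theorem coeff_dpow_mul_const (m n : ℤ) (a : V) :
    (dpow D m * const D a).coeff n = powCoeff (D : Module.End F V) m n a := by
  rw [coeff_mul, finsum_eq_single _ (m, (0 : ℤ))]
  · simp [mulTerm]
  · rintro ⟨p, q⟩ h
    by_cases hp : p = m
    · subst hp
      have : q ≠ 0 := fun e => h (by rw [e])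
      simp [mulTerm, this]
    · simp [mulTerm, hp]

theorem coeff_dpow_mul (m : ℤ) (A : PseudoDiffOp D) {N : ℤ} (hN : ∀ n, N < n → A.coeff n = 0)
    (n : ℤ) (J : Finset ℤ) (hJ : ∀ q, n - m ≤ q → q ≤ N → q ∈ J) :
    (dpow D m * A).coeff n = ∑ q ∈ J, powCoeff (D : Module.End F V) m (n - q) (A.coeff q) := by
  rw [coeff_mul_eq_sum (dpow D m) A (M := m) (fun n hn => by simp [hn.ne']) hN n
    -- The interval is empty when `m < n - N`; inserting `m` keeps the only non-zero row in the
    -- index set.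
    (insert m (Finset.Icc (n - N) m)) J
    (fun p _ _ => Finset.mem_insert_of_mem (Finset.mem_Icc.2 (by omega))) hJ,
    Finset.sum_eq_single m]
  · simp
  · intro b _ hb; simp [hb]
  · simp

theorem coeff_mul_const (A : PseudoDiffOp D) (a : V) {M : ℤ} (hM : ∀ n, M < n → A.coeff n = 0)
    (n : ℤ) (I : Finset ℤ) (hI : ∀ q, n ≤ q → q ≤ M → q ∈ I) :
    (A * const D a).coeff n =
      ∑ q ∈ I, A.coeff q * powCoeff (D : Module.End F V) q n a := by
  rw [coeff_mul_eq_sum A (const D a) hM (N := 0) (fun n hn => by simp [hn.ne']) n I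
    (insert 0 (Finset.Icc (n - M) 0)) (fun p h _ => hI _ (by omega) (by omega))
    (fun p _ _ => Finset.mem_insert_of_mem (Finset.mem_Icc.2 (by omega)))]
  refine Finset.sum_congr rfl fun q _ => ?_
  rw [Finset.sum_eq_single 0]
  · simp
  · intro b _ hb; simp [hb]
  · simp

/-! #### The differential part -/

@[simp] theorem coeff_pos (A : PseudoDiffOp D) (n : ℤ) :
    A.pos.coeff n = if 0 ≤ n then A.coeff n else 0 := rfl

theorem pos_add (A B : PseudoDiffOp D) : (A + B).pos = A.pos + B.pos := by
  ext n; simp only [coeff_pos, coeff_add]; split_ifs <;> simp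

theorem pos_pos (A : PseudoDiffOp D) : A.pos.pos = A.pos := by
  ext n; simp only [coeff_pos]; split_ifs <;> simp

/-- A non-negative power has a finite binomial expansion, which stops at `T ^ k`. This is why
differential operators are closed under the product. -/
theorem powCoeff_natCast_of_neg {M : Type*} [AddCommGroup M] [Module F M] (T : Module.End F M)
    (k s : ℤ) (hk : 0 ≤ k) (hs : s < 0) : powCoeff T k s = 0 := by
  obtain ⟨k, rfl⟩ := Int.eq_ofNat_of_zero_le hk
  rw [powCoeff_sub T k s (k - s).toNat (by omega), Ring.choose_natCast,
    Nat.choose_eq_zero_of_lt (by omega)]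
  simp

theorem pos_mul_pos (A B : PseudoDiffOp D) : (A.pos * B.pos).pos = A.pos * B.pos := by
  ext n
  rw [coeff_pos, coeff_mul]
  split_ifs with hn
  · rfl
  symm
  rw [finsum_congr (g := fun _ => 0), finsum_zero]
  rintro ⟨p, q⟩
  by_cases hp : 0 ≤ p <;> by_cases hq : 0 ≤ q <;> simp [mulTerm, hp, hq]
  rw [powCoeff_natCast_of_neg _ _ _ hp (by omega)]
  simp

/-- Two factors of order at most `-1` have a product of order at most `-2`. The bound includes `n =
-1`, so the residue vanishes along with the differential part. -/
theorem coeff_sub_pos_mul_sub_pos (A B : PseudoDiffOp D) (n : ℤ) (hn : -2 < n) :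
    ((A - A.pos) * (B - B.pos)).coeff n = 0 := by
  rw [coeff_mul, finsum_congr (g := fun _ => 0), finsum_zero]
  rintro ⟨p, q⟩
  by_cases hp : 0 ≤ p <;> by_cases hq : 0 ≤ q <;> simp [mulTerm, hp, hq]
  rw [powCoeff_of_lt _ _ _ (by omega)]
  simp

/-! #### Functoriality -/

section Functoriality

variable {W : Type*} [CommRing W] [Algebra F W] {E : Derivation F W W}

/-- Apply a morphism of differential algebras to all coefficients. -/
noncomputable def mapHom (φ : V →ₐ[F] W) (hφ : ∀ v, φ (D v) = E (φ v)) :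
    PseudoDiffOp D →+* PseudoDiffOp E where
  toFun A := ⟨fun n => φ (A.coeff n), by
    obtain ⟨M, hM⟩ := A.exists_bound
    exact ⟨M, fun n hn => by rw [hM n hn, map_zero]⟩⟩
  map_zero' := by ext n; exact map_zero φ
  map_add' A B := by ext n; exact map_add φ _ _
  map_one' := by
    ext n
    simp only [coeff_one]
    split_ifs <;> simp
  map_mul' A B := by
    ext n
    simp only [coeff_mul]
    refine (φ.toAddMonoidHom.map_finsum (mulTerm_finite A B n)).trans (finsum_congr fun t => ?_)
    simp only [mulTerm]
    refine (map_mul φ _ _).trans ?_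
    congr 1
    exact map_powCoeff φ.toLinearMap _ _ hφ _ _ _

@[simp] theorem coeff_mapHom (φ : V →ₐ[F] W) (hφ : ∀ v, φ (D v) = E (φ v)) (A : PseudoDiffOp D)
    (n : ℤ) : (mapHom φ hφ A).coeff n = φ (A.coeff n) := rfl

/-- Apply a derivation commuting with `∂` to all coefficients. -/
def mapDer (δ : Derivation F W W) : PseudoDiffOp E →+ PseudoDiffOp E where
  toFun A := ⟨fun n => δ (A.coeff n), by
    obtain ⟨M, hM⟩ := A.exists_bound
    exact ⟨M, fun n hn => by rw [hM n hn, map_zero]⟩⟩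
  map_zero' := by ext n; exact map_zero δ
  map_add' A B := by ext n; exact map_add δ _ _

@[simp] theorem coeff_mapDer (δ : Derivation F W W) (A : PseudoDiffOp E) (n : ℤ) :
    (mapDer δ A).coeff n = δ (A.coeff n) := rfl

theorem mapDer_mul (δ : Derivation F W W) (hδ : ∀ w, δ (E w) = E (δ w)) (A B : PseudoDiffOp E) :
    mapDer δ (A * B) = mapDer δ A * B + A * mapDer δ B := by
  ext n
  rw [coeff_add, coeff_mul (mapDer δ A), coeff_mul A (mapDer δ B),
    ← finsum_add_distrib (mulTerm_finite _ _ n) (mulTerm_finite _ _ n), coeff_mapDer, coeff_mul]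
  refine ((δ : W →ₗ[F] W).toAddMonoidHom.map_finsum (mulTerm_finite A B n)).trans
    (finsum_congr fun t => ?_)
  simp only [mulTerm, coeff_mapDer]
  have := map_powCoeff (δ : W →ₗ[F] W) (E : Module.End F W) (E : Module.End F W) hδ t.1 (n - t.2)
    (B.coeff t.2)
  simp only [Derivation.coeFn_coe] at this
  rw [← this]
  refine (δ.leibniz _ _).trans ?_
  simp only [smul_eq_mul]
  ring

theorem mapDer_pos (δ : Derivation F W W) (A : PseudoDiffOp E) :
    mapDer δ A.pos = (mapDer δ A).pos := by
  ext n
  simp only [coeff_mapDer, coeff_pos]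
  split_ifs <;> simp

theorem mapDer_const (δ : Derivation F W W) (a : W) :
    mapDer δ (const E a) = const E (δ a) := by
  ext n; simp only [coeff_mapDer, coeff_const]; split_ifs <;> simp

theorem mapDer_dpow (δ : Derivation F W W) (m : ℤ) : mapDer δ (dpow E m) = 0 := by
  ext n; simp only [coeff_mapDer, coeff_dpow]; split_ifs <;> simp

end Functoriality

/-! #### The residue -/

/-- Integration by parts, `k` times. -/
theorem integral_mul_pow (k : ℕ) (a b : V) :
    integralMap D (a * ((D : Module.End F V) ^ k) b) =
      (-1) ^ k • integralMap D (b * ((D : Module.End F V) ^ k) a) := by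
  induction k generalizing a b with
  | zero => simp [mul_comm]
  | succ k ih =>
    have e1 : ((D : Module.End F V) ^ (k + 1)) b = ((D : Module.End F V) ^ k) (D b) := by
      rw [pow_succ]; rfl
    have e2 : ((D : Module.End F V) ^ (k + 1)) a = D (((D : Module.End F V) ^ k) a) := by
      rw [pow_succ']; rfl
    rw [e1, e2, ih, pow_succ, mul_smul]
    congr 1
    rw [neg_smul, one_smul, ← map_neg, ← sub_eq_zero, ← map_sub]
    refine (Submodule.Quotient.mk_eq_zero _).2 ⟨b * ((D : Module.End F V) ^ k) a, ?_⟩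
    simp
    ring

/-- With `s = m + q + 1`, both sides carry `s` derivatives. Integration by parts costs `(-1) ^ s`,
which is the sign in `binom(m, s) = (-1) ^ s binom(q, s)`, since `q = -m + s - 1`. -/
theorem integral_residue_term (a b : V) (m q : ℤ) :
    integralMap D (a * powCoeff (D : Module.End F V) m (-1 - q) b) =
      integralMap D (b * powCoeff (D : Module.End F V) q (-1 - m) a) := by
  by_cases h : m < -1 - q
  · rw [powCoeff_of_lt _ _ _ h, powCoeff_of_lt _ _ _ (by omega)]; simp
  obtain ⟨s, hs⟩ := Int.le.dest (not_lt.1 h)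
  rw [powCoeff_sub _ m _ s (by omega), powCoeff_sub _ q _ s (by omega)]
  simp only [LinearMap.smul_apply, mul_smul_comm, map_zsmul]
  rw [integral_mul_pow, smul_smul]
  congr 1
  have := Ring.choose_neg (R := ℤ) (-m) s
  rw [neg_neg, show (-m + s - 1 : ℤ) = q by omega] at this
  rw [this]
  simp only [Int.negOnePow, Units.smul_def, zpow_natCast, Units.val_pow_eq_pow_val,
      Units.val_neg, Units.val_one, smul_eq_mul]
  have h2 : ((-1 : ℤ) ^ s) * (-1) ^ s = 1 := by rw [← mul_pow]; simp
  linear_combination (Ring.choose q s) * h2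

/-- `∫ Res` is a trace. -/
theorem integral_residue_mul_comm (A B : PseudoDiffOp D) :
    integralMap D ((A * B).coeff (-1)) = integralMap D ((B * A).coeff (-1)) := by
  obtain ⟨M, hM⟩ := A.exists_bound
  obtain ⟨N, hN⟩ := B.exists_bound
  rw [coeff_mul_eq_sum A B hM hN (-1) (Finset.Icc (-1 - N) M) (Finset.Icc (-1 - M) N)
      (fun s _ _ => Finset.mem_Icc.2 (by omega)) (fun s _ _ => Finset.mem_Icc.2 (by omega)),
    coeff_mul_eq_sum B A hN hM (-1) (Finset.Icc (-1 - M) N) (Finset.Icc (-1 - N) M)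
      (fun s _ _ => Finset.mem_Icc.2 (by omega)) (fun s _ _ => Finset.mem_Icc.2 (by omega)),
    Finset.sum_comm]
  simp only [map_sum]
  exact Finset.sum_congr rfl fun q _ => Finset.sum_congr rfl fun m _ =>
    integral_residue_term _ _ _ _

end PseudoDiffOp

/-! ### Algebra of the Adler map in a split ring with a trace. -/

/-- A ring with a projection `pos` onto a subring along a (non-unital) subring, and a trace
for which both subrings are isotropic. -/
structure TracedSplitting (R G : Type*) [Ring R] [AddCommGroup G] where
  pos : R →+ R
  tr : R →+ G
  pos_pos : ∀ x, pos (pos x) = pos x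
  pos_mul_pos : ∀ x y, pos (pos x * pos y) = pos x * pos y
  pos_neg_mul_neg : ∀ x y, pos ((x - pos x) * (y - pos y)) = 0
  tr_mul_comm : ∀ x y, tr (x * y) = tr (y * x)
  tr_pos_mul_pos : ∀ x y, tr (pos x * pos y) = 0
  tr_neg_mul_neg : ∀ x y, tr ((x - pos x) * (y - pos y)) = 0

namespace TracedSplitting

variable {R G : Type*} [Ring R] [AddCommGroup G] (S : TracedSplitting R G)

/-- The Adler map `A (x B)_+ - (A x)_+ B`, polarised in `A`. -/
def adler (A B x : R) : R := A * S.pos (x * B) - S.pos (A * x) * B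

/-- By isotropy both sides equal `tr (x_+ y_-)`: the two projections are adjoint to each other. -/
theorem tr_pos_mul (x y : R) : S.tr (S.pos x * y) = S.tr (x * (y - S.pos y)) := by
  have h1 := S.tr_pos_mul_pos x y
  have h2 := S.tr_neg_mul_neg x y
  rw [show S.pos x * y = S.pos x * S.pos y + S.pos x * (y - S.pos y) by noncomm_ring, map_add, h1,
    zero_add]
  rw [sub_mul, map_sub, sub_eq_zero] at h2
  exact h2.symm

theorem tr_pos_mul_add (x y : R) : S.tr (S.pos x * y) + S.tr (x * S.pos y) = S.tr (x * y) := by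
  rw [tr_pos_mul, ← map_add]; congr 1; noncomm_ring

/-- By cyclicity the terms with `(x B)_+` and `(y A)_+` add up to `tr (x B y A)`, and those with `(A
x)_+` and `(B y)_+` to `tr (A x B y)`, by `tr_pos_mul_add`. These two traces agree. Keeping `A` and
`B` distinct allows the identity to be differentiated in `A`. -/
theorem tr_adler_skew (A B x y : R) :
    S.tr (S.adler A B x * y) + S.tr (S.adler B A y * x) = 0 := by
  have h1 := S.tr_pos_mul_add (x * B) (y * A)
  have h2 := S.tr_pos_mul_add (A * x) (B * y)
  have c1 := S.tr_mul_comm A (S.pos (x * B) * y)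
  have c2 := S.tr_mul_comm (x * B) (S.pos (y * A))
  have c4 := S.tr_mul_comm (A * x) (S.pos (B * y))
  have c5 := S.tr_mul_comm (x * B * y) A
  have c7 := S.tr_mul_comm B (S.pos (y * A) * x)
  simp only [adler, sub_mul, map_sub, mul_assoc] at *
  rw [c1, c7, ← c2, ← c4]
  linear_combination (norm := abel) h1 - h2 + c5

/-- The coefficient of the bracket of two Adler vector fields. -/
def adlerComm (A x y : R) : R :=
  S.pos (x * A) * y + (y * A - S.pos (y * A)) * x - x * (A * y - S.pos (A * y)) -
    y * S.pos (A * x)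

/-- The Adler vector fields are closed under commutator. The mixed terms `(A x)_+ A (y A)_+` and `(A
y)_+ A (x A)_+` are symmetric in `x` and `y` and drop out. The remaining difference is `A e₁ - e₂
A`, where `e₁` and `e₂` (the left sides of `e1` and `e2`) vanish because both halves of the
splitting are closed under the product. -/
theorem adler_commutator (A x y : R) :
    (S.adler (S.adler A A x) A y + S.adler A (S.adler A A x) y) -
      (S.adler (S.adler A A y) A x + S.adler A (S.adler A A y) x) =
    S.adler A A (S.adlerComm A x y) := by
  have k1 := S.pos_neg_mul_neg (x * A) (y * A)
  have k2 := S.pos_neg_mul_neg (y * A) (x * A)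
  have k3 := S.pos_neg_mul_neg (A * x) (A * y)
  have k4 := S.pos_neg_mul_neg (A * y) (A * x)
  have m1 := S.pos_mul_pos (x * A) (y * A)
  have m2 := S.pos_mul_pos (y * A) (x * A)
  have m3 := S.pos_mul_pos (A * x) (A * y)
  have m4 := S.pos_mul_pos (A * y) (A * x)
  simp only [mul_sub, sub_mul, map_sub] at k1 k2 k3 k4
  rw [m1] at k1; rw [m2] at k2; rw [m3] at k3; rw [m4] at k4
  have e1 : S.pos (x * A) * S.pos (y * A) - S.pos (y * A) * S.pos (x * A) +
      S.pos (y * (A * S.pos (x * A) - S.pos (A * x) * A)) -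
      S.pos (x * (A * S.pos (y * A) - S.pos (A * y) * A)) -
      S.pos (S.adlerComm A x y * A) = 0 := by
    simp only [adlerComm, mul_sub, sub_mul, add_mul, map_sub, map_add, mul_assoc] at k1 k2 ⊢
    linear_combination (norm := abel) k1 - k2
  have e2 : S.pos ((A * S.pos (x * A) - S.pos (A * x) * A) * y) - S.pos (A * y) * S.pos (A * x) -
      S.pos ((A * S.pos (y * A) - S.pos (A * y) * A) * x) + S.pos (A * x) * S.pos (A * y) -
      S.pos (A * S.adlerComm A x y) = 0 := by
    simp only [adlerComm, mul_sub, sub_mul, mul_add, map_sub, map_add, mul_assoc] at k3 k4 ⊢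
    linear_combination (norm := abel) k3 - k4
  rw [← sub_eq_zero]
  have e3 := congrArg (fun t => A * t) e1
  have e4 := congrArg (fun t => t * A) e2
  simp only [mul_zero, zero_mul] at e3 e4
  rw [← sub_eq_zero.2 (e3.trans e4.symm)]
  simp only [adler]
  noncomm_ring

/-- `tr (δ_x δ_y A · w)` for the Adler vector fields `δ_x A = A (x A)_+ - (A x)_+ A`. -/
def adlerTriple (A x y w : R) : G :=
  S.tr ((S.adler (S.adler A A x) A y + S.adler A (S.adler A A x) y) * w)

/-- This is the derivative of `tr_adler_skew` along the Adler vector field of `x`; each of the two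
copies of `A` contributes one polarised instance. -/
theorem adlerTriple_skew (A x y w : R) :
    S.adlerTriple A x y w = -S.adlerTriple A x w y := by
  have h1 := S.tr_adler_skew (S.adler A A x) A y w
  have h2 := S.tr_adler_skew A (S.adler A A x) y w
  simp only [adlerTriple, add_mul, map_add]
  rw [eq_neg_iff_add_eq_zero, ← add_zero (0 : G)]
  nth_rewrite 1 [← h1]
  rw [← h2]
  abel

/-- `adlerComm A x y` is the gradient in `A` of `tr (adler A A x * y)`, so the identity holds for
every direction `B` in place of `adler A A w`. -/
theorem adlerTriple_eq_comm (A x y w : R) :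
    S.adlerTriple A w x y = S.tr (S.adler A A w * S.adlerComm A x y) := by
  unfold adlerTriple
  generalize S.adler A A w = B
  have a1 := S.tr_pos_mul (y * A) (x * B)
  have a2 := S.tr_pos_mul (B * x) (A * y)
  have c1 := S.tr_mul_comm A (S.pos (x * B) * y)
  have c2 := S.tr_mul_comm (S.pos (x * B)) (y * A)
  have a3 := S.tr_pos_mul_add (x * B) (y * A)
  have c4 := S.tr_mul_comm (x * B) (y * A - S.pos (y * A))
  have c5 := S.tr_mul_comm B ((y * A - S.pos (y * A)) * x)
  have c6 := S.tr_mul_comm B (y * S.pos (A * x))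
  have c7 := S.tr_mul_comm (S.pos (A * x) * B) y
  simp only [adler, adlerComm, sub_mul, mul_sub, mul_add, add_mul, map_sub, map_add,
    mul_assoc] at *
  linear_combination (norm := abel) c1 + a3 + c4 - c5 - a2 + c6 - c7

/-- The algebraic core of the Jacobi identity. After a skew exchange in the second triple, the first
two form the commutator of the fields of `x` and `y`, which is the Adler field of `c = adlerComm A x
y`, paired with `w`. The third is the Adler field of `w` paired with `c`, and `tr_adler_skew`
cancels the two. -/
theorem adlerTriple_cyclic (A x y w : R) :
    S.adlerTriple A x y w + S.adlerTriple A y w x + S.adlerTriple A w x y = 0 := by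
  rw [S.adlerTriple_skew A y w x, S.adlerTriple_eq_comm A x y w]
  have h := congrArg (fun t => S.tr (t * w)) (S.adler_commutator A x y)
  have h2 := S.tr_adler_skew A A w (S.adlerComm A x y)
  simp only [sub_mul, map_sub] at h
  simp only [adlerTriple]
  rw [← sub_eq_add_neg, h, add_comm]
  exact h2

/-- The Adler map of `A`, paired with `g` commuting with `A`. -/
theorem tr_mul_adler (A g y : R) (hg : g * A = A * g) :
    S.tr (g * S.adler A A y) = S.tr ((S.pos (g * A) * A - A * S.pos (g * A)) * y) := by
  have a1 := S.tr_pos_mul (g * A) (y * A)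
  have a2 := S.tr_pos_mul (A * y) (A * g)
  have a3 := S.tr_pos_mul_add (g * A) (y * A)
  have a4 := S.tr_pos_mul_add (A * g) (A * y)
  have c1 := S.tr_mul_comm (S.pos (g * A) * y) A
  have c2 := S.tr_mul_comm (A * g * y) A
  have c3 := S.tr_mul_comm (g * S.pos (A * y)) A
  have hg2 : A * g * A = A * A * g := by rw [mul_assoc, hg, ← mul_assoc]
  simp only [adler, sub_mul, mul_sub, map_sub, ← mul_assoc, hg, hg2] at a1 a2 a3 a4 c1 c2 c3 ⊢
  linear_combination (norm := abel) a3 - a4 - c1 + c2 - c3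

/-- The linear part in `ε` of the Adler map of `A + ε`, paired with `g` commuting with `A`. -/
theorem tr_mul_adler_one (A g y : R) (hg : g * A = A * g) :
    S.tr (g * (S.adler A 1 y + S.adler 1 A y)) =
      S.tr ((S.pos g * A - A * S.pos g) * y) := by
  have a3 := S.tr_pos_mul_add g (y * A)
  have a4 := S.tr_pos_mul_add g (A * y)
  have c1 := S.tr_mul_comm (S.pos g * y) A
  have c2 := S.tr_mul_comm (g * S.pos y) A
  have c3 := S.tr_mul_comm (g * y) A
  have c4 := S.tr_mul_comm (S.pos y * A) g
  simp only [adler, sub_mul, mul_sub, mul_add, map_sub, map_add, mul_one, one_mul,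
    ← mul_assoc, hg] at a3 a4 c1 c2 c3 c4 ⊢
  linear_combination (norm := abel) a3 - a4 - c1 - c2 + c3

end TracedSplitting

/-! ### Derivations of powers under a trace. -/

section TraceDerivation

variable {R G : Type*} [Ring R] [AddCommGroup G] (T : R →+ G) (hT : ∀ x y, T (x * y) = T (y * x))
  (δ : R →+ R) (hδ : ∀ x y, δ (x * y) = δ x * y + x * δ y)

include hT hδ in
-- Under the trace all powers of `B` around `δB` can be collected, since `g` commutes with `B`. For
-- negative exponents the product rule for `B ^ (n - 1) * B = B ^ n` is solved for the lower power.
theorem trace_derivation_zpow (B : Rˣ) (n : ℤ) (g : R) (hg : g * B = B * g) :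
    T (g * δ ↑(B ^ n)) = n • T (g * ↑(B ^ (n - 1)) * δ B) := by
  have hinv : ∀ g : R, g * B = B * g → g * (↑B⁻¹ : R) * B = B * (g * (↑B⁻¹ : R)) := by
    intro g hg
    rw [mul_assoc, Units.inv_mul, mul_one, ← mul_assoc, ← hg, mul_assoc, Units.mul_inv, mul_one]
  induction n generalizing g with
  | zero =>
    have : δ 1 = 0 := by simpa using hδ 1 1
    simp [this]
  | succ n ih =>
    -- The trailing factor `B` produced by the product rule moves to the front under the trace and
    -- is absorbed into `g`; hence the induction over all `g`.
    have h1 := ih (B * g) (by rw [mul_assoc, hg])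
    have e1 : g * δ ↑(B ^ ((n : ℤ) + 1)) =
        g * δ ↑(B ^ (n : ℤ)) * B + g * ↑(B ^ (n : ℤ)) * δ B := by
      rw [zpow_add_one, Units.val_mul, hδ]; noncomm_ring
    rw [e1, map_add, hT, ← mul_assoc, h1, add_smul, one_smul]
    congr 3
    · rw [← hg, mul_assoc g, ← Units.val_mul, ← zpow_one_add, show (1 + (n - 1 : ℤ)) = n by ring,
        add_sub_cancel_right]
    · rw [add_sub_cancel_right]
  | pred n ih =>
    have h1 := ih (g * (↑B⁻¹ : R)) (hinv g hg)
    have e0 : (↑(B ^ (-(n : ℤ))) : R) = ↑(B ^ (-(n : ℤ) - 1)) * B := by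
      rw [← Units.val_mul, ← zpow_add_one]; congr 2; ring
    have e1 : g * (↑B⁻¹ : R) * δ ↑(B ^ (-(n : ℤ))) =
        g * (↑B⁻¹ : R) * δ ↑(B ^ (-(n : ℤ) - 1)) * B +
          g * (↑B⁻¹ : R) * ↑(B ^ (-(n : ℤ) - 1)) * δ B := by
      rw [e0, hδ]; noncomm_ring
    have e2 : (B : R) * (g * ↑B⁻¹ * δ ↑(B ^ (-(n : ℤ) - 1))) = g * δ ↑(B ^ (-(n : ℤ) - 1)) := by
      rw [← mul_assoc, ← hinv g hg, mul_assoc g, Units.inv_mul, mul_one]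
    have e3 : g * (↑B⁻¹ : R) * ↑(B ^ (-(n : ℤ) - 1)) = g * ↑(B ^ (-(n : ℤ) - 1 - 1)) := by
      rw [mul_assoc, ← Units.val_mul, ← zpow_neg_one, ← zpow_add]; congr 3; ring
    rw [e1, map_add, hT, e2, e3] at h1
    rw [sub_smul, one_smul, eq_sub_iff_add_eq, h1]

include hT hδ in
/-- For a `K`-th root `B` of `A`, `K tr δ(B ^ n) = n tr (B ^ (n - K) δA)`. -/
theorem trace_derivation_root (B : Rˣ) (n K : ℤ) :
    K • T (δ ↑(B ^ n)) = n • T (↑(B ^ (n - K)) * δ ↑(B ^ K)) := by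
  have hc : ∀ n : ℤ, (↑(B ^ n) : R) * B = B * ↑(B ^ n) := fun n => by
    rw [← Units.val_mul, ← Units.val_mul, ← zpow_add_one, ← zpow_one_add, add_comm]
  -- Both sides are `n K tr (B ^ (n - 1) δB)`, so no division by `K` or `n` is needed.
  have h1 := trace_derivation_zpow T hT δ hδ B n 1 (by simp)
  have h2 := trace_derivation_zpow T hT δ hδ B K ↑(B ^ (n - K)) (hc _)
  rw [one_mul, one_mul] at h1
  rw [h1, h2, ← Units.val_mul, ← zpow_add, smul_comm, show n - K + (K - 1) = n - 1 by ring]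

end TraceDerivation

namespace PseudoDiffOp

variable {F : Type*} [Field F] {V : Type*} [CommRing V] [Algebra F V] {D : Derivation F V V}

/-! #### Matrix operators -/

/-- The splitting of matrix operators into differential and integral parts, with the trace
`∫ Res tr`. -/
noncomputable def matrixSplitting (D : Derivation F V V) (N : ℕ) :
    TracedSplitting (Matrix (Fin N) (Fin N) (PseudoDiffOp D)) (LocalFunctional D) where
  pos :=
    { toFun := fun M => M.map pos
      map_zero' := by ext i j n; simp
      map_add' := fun M M' => by ext i j n; simp [pos_add] }
  tr :=
    { toFun := fun M => integralMap D ((Matrix.trace M).coeff (-1))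
      map_zero' := by simp
      map_add' := fun M M' => by simp }
  pos_pos M := by ext1 i j; exact pos_pos _
  pos_mul_pos M M' := by
    ext i j n
    simp only [AddMonoidHom.coe_mk, ZeroHom.coe_mk, Matrix.map_apply, Matrix.mul_apply]
    rw [coeff_pos, coeff_sum]
    split_ifs with h
    · rfl
    · refine (Finset.sum_eq_zero fun k _ => ?_).symm
      rw [← pos_mul_pos, coeff_pos, if_neg h]
  pos_neg_mul_neg M M' := by
    ext i j n
    simp only [AddMonoidHom.coe_mk, ZeroHom.coe_mk, Matrix.map_apply, Matrix.mul_apply,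
      Matrix.sub_apply, coeff_pos, coeff_sum]
    split_ifs with h
    · exact Finset.sum_eq_zero fun k _ => coeff_sub_pos_mul_sub_pos _ _ _ (by omega)
    · rfl
  tr_mul_comm M M' := by
    simp only [AddMonoidHom.coe_mk, ZeroHom.coe_mk, Matrix.trace, Matrix.diag_apply,
      Matrix.mul_apply, coeff_sum, map_sum]
    rw [Finset.sum_comm]
    exact Finset.sum_congr rfl fun i _ => Finset.sum_congr rfl fun j _ =>
      integral_residue_mul_comm _ _
  tr_pos_mul_pos M M' := by
    simp only [AddMonoidHom.coe_mk, ZeroHom.coe_mk, Matrix.trace, Matrix.diag_apply,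
      Matrix.mul_apply, coeff_sum, Matrix.map_apply]
    rw [Finset.sum_eq_zero, map_zero]
    refine fun i _ => Finset.sum_eq_zero fun j _ => ?_
    rw [← pos_mul_pos, coeff_pos, if_neg (by norm_num)]
  tr_neg_mul_neg M M' := by
    simp only [AddMonoidHom.coe_mk, ZeroHom.coe_mk, Matrix.trace, Matrix.diag_apply,
      Matrix.mul_apply, coeff_sum, Matrix.map_apply, Matrix.sub_apply]
    rw [Finset.sum_eq_zero, map_zero]
    exact fun i _ => Finset.sum_eq_zero fun j _ => coeff_sub_pos_mul_sub_pos _ _ _ (by omega)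

variable {N : ℕ}

theorem matrixSplitting_pos_apply (M : Matrix (Fin N) (Fin N) (PseudoDiffOp D)) :
    (matrixSplitting D N).pos M = M.map pos := rfl

theorem matrixSplitting_tr_apply (M : Matrix (Fin N) (Fin N) (PseudoDiffOp D)) :
    (matrixSplitting D N).tr M = integralMap D ((Matrix.trace M).coeff (-1)) := rfl

/-- The matrix operator `∂ ^ (-1 - n) ∘ g` placed at position `(k, h)`; pairing with it under
`∫ Res tr` extracts `∫ g M_{hk,n}`. -/
noncomputable def testOp (k h : Fin N) (n : ℤ) (g : V) :
    Matrix (Fin N) (Fin N) (PseudoDiffOp D) :=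
  Matrix.single k h (dpow D (-1 - n) * const D g)

theorem tr_mul_testOp (M : Matrix (Fin N) (Fin N) (PseudoDiffOp D)) (k h : Fin N) (n : ℤ) (g : V) :
    (matrixSplitting D N).tr (M * testOp k h n g) = integralMap D (g * (M h k).coeff n) := by
  rw [matrixSplitting_tr_apply]
  have : Matrix.trace (M * testOp k h n g) = M h k * (dpow D (-1 - n) * const D g) := by
    simp only [Matrix.trace, Matrix.diag_apply, testOp]
    rw [Finset.sum_eq_single h]
    · simp
    · intro i _ hi
      rw [Matrix.mul_single_apply_of_ne _ _ _ _ _ hi]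
    · simp
  rw [this, ← mul_assoc, integral_residue_mul_comm, coeff_const_mul, coeff_mul_dpow]
  congr 3
  ring

theorem adler_testOp_apply (A : Matrix (Fin N) (Fin N) (PseudoDiffOp D)) (i j h k : Fin N) (m : ℤ)
    (f : V) :
    (matrixSplitting D N).adler A A (testOp j i m f) h k =
      A h j * (dpow D (-1 - m) * const D f * A i k).pos -
        (A h j * (dpow D (-1 - m) * const D f)).pos * A i k := by
  simp only [TracedSplitting.adler, matrixSplitting_pos_apply, Matrix.sub_apply]
  congr 1
  · rw [Matrix.mul_apply, Finset.sum_eq_single j]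
    · simp [testOp]
    · intro p _ hp
      rw [Matrix.map_apply, testOp, Matrix.single_mul_apply_of_ne _ _ _ _ _ hp]
      ext n; simp [coeff_mul, mulTerm]
    · simp
  · rw [Matrix.mul_apply, Finset.sum_eq_single i]
    · simp [testOp]
    · intro p _ hp
      rw [Matrix.map_apply, testOp, Matrix.mul_single_apply_of_ne _ _ _ _ _ hp]
      ext n; simp [coeff_mul, mulTerm]
    · simp

/-- Entrywise action of a derivation on matrix operators. -/
noncomputable def matrixDer (δ : Derivation F V V) (N : ℕ) :
    Matrix (Fin N) (Fin N) (PseudoDiffOp D) →+ Matrix (Fin N) (Fin N) (PseudoDiffOp D) :=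
  (mapDer δ).mapMatrix

theorem matrixDer_apply (δ : Derivation F V V) (M : Matrix (Fin N) (Fin N) (PseudoDiffOp D))
    (i j : Fin N) : matrixDer δ N M i j = mapDer δ (M i j) := rfl

theorem matrixDer_mul (δ : Derivation F V V) (hδ : ∀ v, δ (D v) = D (δ v))
    (M M' : Matrix (Fin N) (Fin N) (PseudoDiffOp D)) :
    matrixDer δ N (M * M') = matrixDer δ N M * M' + M * matrixDer δ N M' := by
  ext1 i j
  simp only [matrixDer_apply, Matrix.mul_apply, Matrix.add_apply, map_sum, mapDer_mul δ hδ,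
    Finset.sum_add_distrib]

theorem matrixDer_pos (δ : Derivation F V V) (M : Matrix (Fin N) (Fin N) (PseudoDiffOp D)) :
    matrixDer δ N ((matrixSplitting D N).pos M) = (matrixSplitting D N).pos (matrixDer δ N M) := by
  ext1 i j
  exact mapDer_pos _ _

/-- Hamiltonian vector fields kill the jet variables, so test operators are constants for them and
only the two copies of `A` in the Adler map get differentiated. -/
theorem matrixDer_testOp (δ : Derivation F V V) (hδ : ∀ v, δ (D v) = D (δ v)) (k h : Fin N) (n : ℤ)
    (g : V) (hg : δ g = 0) : matrixDer (D := D) δ N (testOp k h n g) = 0 := by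
  have h0 : mapDer δ (dpow D (-1 - n) * const D g) = 0 := by
    rw [mapDer_mul δ hδ, mapDer_dpow, mapDer_const, hg]
    have : const D (0 : V) = 0 := by ext n; simp
    rw [this, zero_mul, mul_zero, add_zero]
  ext1 i j
  rw [matrixDer_apply, testOp, Matrix.single_apply]
  split_ifs
  · exact h0
  · exact map_zero _

theorem matrixDer_adler (δ : Derivation F V V) (hδ : ∀ v, δ (D v) = D (δ v))
    (A x : Matrix (Fin N) (Fin N) (PseudoDiffOp D)) (hx : matrixDer δ N x = 0) :
    matrixDer δ N ((matrixSplitting D N).adler A A x) =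
      (matrixSplitting D N).adler (matrixDer δ N A) A x +
        (matrixSplitting D N).adler A (matrixDer δ N A) x := by
  simp only [TracedSplitting.adler, map_sub, matrixDer_mul δ hδ, matrixDer_pos, hx, zero_mul,
    mul_zero, zero_add, add_zero]
  abel

theorem integral_derivation_residue_trace (δ : Derivation F V V)
    (M : Matrix (Fin N) (Fin N) (PseudoDiffOp D)) :
    integralMap D (δ ((Matrix.trace M).coeff (-1))) =
      (matrixSplitting D N).tr (matrixDer δ N M) := by
  simp [matrixSplitting_tr_apply, Matrix.trace, matrixDer_apply]

end PseudoDiffOp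

/-! ### Evaluating `λ`-brackets on functions -/

section Evaluation

variable {F : Type*} [Field F] {V : Type*} [CommRing V] [Algebra F V] {D : Derivation F V V}
  {W : Type*} [CommRing W] [Algebra F W] (E : Derivation F W W) (φ : V →ₐ[F] W)

/-- `p(∂) f = ∑ n, p_n ∂ ^ n f`. -/
noncomputable def jetEval (f : W) : V[X] →ₗ[F] W :=
  Polynomial.lsum fun n => LinearMap.mulRight F (((E : Module.End F W) ^ n) f) ∘ₗ φ.toLinearMap

/-- The adjoint `p(∂)^* f = ∑ n, (-∂) ^ n (p_n f)`. -/
noncomputable def jetCoeval (f : W) : V[X] →ₗ[F] W :=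
  Polynomial.lsum fun n => ((-(E : Module.End F W)) ^ n) ∘ₗ LinearMap.mulRight F f ∘ₗ φ.toLinearMap

theorem jetEval_monomial (f : W) (n : ℕ) (c : V) :
    jetEval E φ f (monomial n c) = φ c * ((E : Module.End F W) ^ n) f := by
  simp [jetEval, Polynomial.lsum_apply]

theorem jetCoeval_monomial (f : W) (n : ℕ) (c : V) :
    jetCoeval E φ f (monomial n c) = ((-(E : Module.End F W)) ^ n) (φ c * f) := by
  simp [jetCoeval, Polynomial.lsum_apply]

theorem jetEval_C (f : W) (c : V) : jetEval E φ f (C c) = φ c * f := by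
  rw [← monomial_zero_left, jetEval_monomial]; simp

theorem jetCoeval_C (f : W) (c : V) : jetCoeval E φ f (C c) = φ c * f := by
  rw [← monomial_zero_left, jetCoeval_monomial]; simp

theorem jetEval_C_mul (f : W) (c : V) (q : V[X]) :
    jetEval E φ f (C c * q) = φ c * jetEval E φ f q := by
  induction q using Polynomial.induction_on' with
  | add p q hp hq => rw [mul_add, map_add, map_add, hp, hq, mul_add]
  | monomial n a => rw [C_mul_monomial, jetEval_monomial, jetEval_monomial, map_mul, mul_assoc]

theorem lambdaAdd_monomial (D : Derivation F V V) (n : ℕ) (a : V) :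
    lambdaAdd D (monomial n a) = monomial (n + 1) a + monomial n (D a) := by
  ext k
  rw [coeff_lambdaAdd, X_mul_monomial, coeff_add]
  congr 1
  simp only [coeff_monomial]
  split_ifs <;> simp

variable {E φ} in
theorem jetEval_lambdaAdd (hφ : ∀ v, φ (D v) = E (φ v)) (f : W) (q : V[X]) :
    jetEval E φ f (lambdaAdd D q) = E (jetEval E φ f q) := by
  induction q using Polynomial.induction_on' with
  | add p q hp hq => rw [map_add, map_add, map_add, hp, hq, map_add]
  | monomial n a =>
    rw [lambdaAdd_monomial, map_add, jetEval_monomial, jetEval_monomial, jetEval_monomial, hφ,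
      pow_succ', E.leibniz]
    simp only [Module.End.mul_apply, Derivation.coeFn_coe, smul_eq_mul]
    ring

theorem jetCoeval_C_mul (f : W) (c : V) (q : V[X]) :
    jetCoeval E φ f (C c * q) = jetCoeval E φ (φ c * f) q := by
  induction q using Polynomial.induction_on' with
  | add p q hp hq => rw [mul_add, map_add, map_add, hp, hq]
  | monomial n a =>
    rw [C_mul_monomial, jetCoeval_monomial, jetCoeval_monomial, map_mul φ]
    congr 1; ring

theorem jetCoeval_X_mul (f : W) (q : V[X]) :
    jetCoeval E φ f (X * q) = -E (jetCoeval E φ f q) := by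
  induction q using Polynomial.induction_on' with
  | add p q hp hq => rw [mul_add, map_add, map_add, hp, hq, map_add, neg_add]
  | monomial n a =>
    rw [X_mul_monomial, jetCoeval_monomial, jetCoeval_monomial, pow_succ']
    rfl

variable {E φ} in
theorem jetCoeval_lambdaAdd (hφ : ∀ v, φ (D v) = E (φ v)) (f : W) (q : V[X]) :
    jetCoeval E φ f (lambdaAdd D q) = jetCoeval E φ (-E f) q := by
  induction q using Polynomial.induction_on' with
  | add p q hp hq => rw [map_add, map_add, map_add, hp, hq]
  | monomial n a =>
    rw [lambdaAdd_monomial, map_add, jetCoeval_monomial, jetCoeval_monomial, jetCoeval_monomial, hφ,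
      pow_succ, Module.End.mul_apply, ← map_add]
    congr 1
    simp only [LinearMap.neg_apply, Derivation.coeFn_coe, Derivation.leibniz, smul_eq_mul]
    ring

variable {E φ} in
-- Passing to adjoints turns the shifted factor of the left Leibniz rule into plain multiplication
-- by `b`; this makes `a ↦ {a_∂ u}^* f` a derivation.
theorem jetCoeval_shiftApply (hφ : ∀ v, φ (D v) = E (φ v)) (f : W) (p : V[X]) (b : V) :
    jetCoeval E φ f (shiftApply D p b) = φ b * jetCoeval E φ f p := by
  induction p using Polynomial.induction_on' with
  | add p q hp hq => rw [shiftApply_add, map_add, map_add, hp, hq, mul_add]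
  | monomial n a =>
    have h : ∀ (g : W), jetCoeval E φ g ((lambdaAdd D ^ n) (C b)) =
        φ b * ((-(E : Module.End F W)) ^ n) g := by
      induction n with
      | zero => intro g; simp [jetCoeval_C]
      | succ n ih =>
        intro g
        rw [pow_succ', Module.End.mul_apply, jetCoeval_lambdaAdd hφ, ih, pow_succ]
        rfl
    rw [shiftApply, sum_monomial_index _ _ (by simp), jetCoeval_C_mul, h, jetCoeval_monomial]

variable {E φ} in
-- `negShift` is the symbol of the formal adjoint, so skewsymmetry of a `λ`-bracket reads `{b_∂ a} =
-- -{a_∂ b}^*`.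
theorem jetEval_negShift (hφ : ∀ v, φ (D v) = E (φ v)) (f : W) (p : V[X]) :
    jetEval E φ f (negShift D p) = jetCoeval E φ f p := by
  have hadd : ∀ p q, negShift D (p + q) = negShift D p + negShift D q := fun p q =>
    sum_add_index p q _ (fun _ => by simp) (fun _ _ _ => by rw [C_add, map_add])
  induction p using Polynomial.induction_on' with
  | add p q hp hq => rw [hadd, map_add, map_add, hp, hq]
  | monomial n a =>
    have h : ∀ q : V[X], jetEval E φ f (((-lambdaAdd D) ^ n) q) =
        ((-(E : Module.End F W)) ^ n) (jetEval E φ f q) := by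
      induction n with
      | zero => simp
      | succ n ih =>
        intro q
        rw [pow_succ, Module.End.mul_apply, ih, pow_succ, Module.End.mul_apply]
        simp only [LinearMap.neg_apply, map_neg, jetEval_lambdaAdd hφ]
        rfl
    rw [negShift, sum_monomial_index _ _ (by simp), h, jetEval_C, jetCoeval_monomial]

theorem integral_mul_jetEval (f g : W) (p : V[X]) :
    integralMap E (g * jetEval E φ f p) = integralMap E (f * jetCoeval E φ g p) := by
  induction p using Polynomial.induction_on' with
  | add p q hp hq => simp only [map_add, mul_add, hp, hq]
  | monomial n a =>
    rw [jetEval_monomial, jetCoeval_monomial, ← mul_assoc,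
      PseudoDiffOp.integral_mul_pow, neg_pow (E : Module.End F W), mul_comm g]
    rcases Nat.even_or_odd n with h | h <;> simp [h.neg_one_pow]

/-- Moving the adjoint back gives `p(∂) 1 = p_0`. This is how the specialisation `λ = 0` in `{∫h,
u}` arises. -/
theorem integral_jetCoeval (f : W) (p : V[X]) :
    integralMap E (jetCoeval E φ f p) = integralMap E (f * φ (p.coeff 0)) := by
  have h := integral_mul_jetEval E φ 1 f p
  rw [one_mul] at h
  rw [← h]
  congr 2
  have h1 : ∀ n : ℕ, ((E : Module.End F W) ^ (n + 1)) 1 = 0 := fun n => by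
    rw [pow_succ, Module.End.mul_apply]; simp
  induction p using Polynomial.induction_on' with
  | add p q hp hq =>
    rw [map_add, coeff_add, map_add, hp, hq]
    · simpa using integral_mul_jetEval E φ 1 f q
    · simpa using integral_mul_jetEval E φ 1 f p
  | monomial n a =>
    rw [jetEval_monomial]
    cases n with
    | zero => simp
    | succ n => rw [h1]; simp

end Evaluation

/-! ### The Adler identity as an identity between operators. -/

namespace PseudoDiffOp

variable {F : Type*} [Field F] {V : Type*} [CommRing V] [Algebra F V] {D : Derivation F V V}

/-- Right multiplication by a function preserves both differential operators and operators of
negative order. -/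
theorem pos_mul_const (A : PseudoDiffOp D) (f : V) : (A * const D f).pos = A.pos * const D f := by
  obtain ⟨M, hM⟩ := A.exists_bound
  have hM' : ∀ n, M < n → A.pos.coeff n = 0 := fun n hn => by simp [hM n hn]
  ext n
  rw [coeff_pos]
  split_ifs with h
  · rw [coeff_mul_const A f hM n (Finset.Icc n M) (fun q _ _ => Finset.mem_Icc.2 (by omega)),
      coeff_mul_const A.pos f hM' n (Finset.Icc n M) (fun q _ _ => Finset.mem_Icc.2 (by omega))]
    refine Finset.sum_congr rfl fun q hq => ?_
    rw [Finset.mem_Icc] at hq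
    rw [coeff_pos, if_pos (by omega)]
  · rw [coeff_mul_const A.pos f hM' n (Finset.Icc n M) (fun q _ _ => Finset.mem_Icc.2 (by omega)),
      Finset.sum_eq_zero]
    intro q _
    rw [coeff_pos]
    split_ifs with hq
    · rw [powCoeff_natCast_of_neg _ _ _ hq (by omega)]; simp
    · simp

theorem coeff_mul_dpow_mul_const (A : PseudoDiffOp D) (a : V) {M : ℤ}
    (hM : ∀ n, M < n → A.coeff n = 0) (k n : ℤ) (I : Finset ℤ)
    (hI : ∀ q, n - k ≤ q → q ≤ M → q ∈ I) :
    (A * (dpow D k * const D a)).coeff n =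
      ∑ q ∈ I, A.coeff q * powCoeff (D : Module.End F V) (q + k) n a := by
  rw [← mul_assoc, coeff_mul_const (A * dpow D k) a (M := M + k)
    (fun n hn => by rw [coeff_mul_dpow, hM _ (by omega)]) n (I.map (Equiv.addRight k).toEmbedding)]
  · simp [coeff_mul_dpow]
  · intro q h1 h2
    simp only [Finset.mem_map, Equiv.coe_toEmbedding, Equiv.coe_addRight]
    exact ⟨q - k, hI _ (by omega) (by omega), by ring⟩

/-- The coefficients on the right are those of `z ^ (m + k + 1)` in `∑ p, (z - ∂) ^ p (Q_p f)`,
which is the form in which `Q^*(λ - z)` enters the Adler identity. Term by term this is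
`powCoeff_neg_one_sub`. -/
theorem pos_dpow_mul_const_mul (Q : PseudoDiffOp D) (f : V) (m : ℤ) {N : ℤ}
    (hN : ∀ n, N < n → Q.coeff n = 0) (K : ℕ) (hK : N - m ≤ K) :
    (dpow D (-1 - m) * const D f * Q).pos =
      ∑ k ∈ Finset.range K, ∑ p ∈ Finset.Icc (m + 1) N, dpow D k *
        const D (powCoeff (-(D : Module.End F V)) p (m + k + 1) (Q.coeff p * f)) := by
  ext r
  rw [mul_assoc]
  simp only [coeff_sum, coeff_dpow_mul_const, coeff_pos]
  split_ifs with h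
  · rw [coeff_dpow_mul _ _ (N := N) (fun n hn => by rw [coeff_const_mul, hN n hn, mul_zero]) r
      (Finset.Icc (m + 1) N) (fun q _ _ => Finset.mem_Icc.2 (by omega)), Finset.sum_comm]
    refine Finset.sum_congr rfl fun p hp => ?_
    rw [Finset.mem_Icc] at hp
    rw [coeff_const_mul, mul_comm f]
    exact powCoeff_neg_one_sub _ m p r h K (by omega) _
  · symm
    refine Finset.sum_eq_zero fun k _ => Finset.sum_eq_zero fun p _ => ?_
    rw [powCoeff_natCast_of_neg _ _ _ (by omega) (by omega)]; rfl

theorem pos_mul_dpow (P : PseudoDiffOp D) (m : ℤ) {M : ℤ}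
    (hM : ∀ n, M < n → P.coeff n = 0) (K : ℕ) (hK : M - m ≤ K) :
    (P * dpow D (-1 - m)).pos =
      ∑ k ∈ Finset.range K, const D (P.coeff (m + k + 1)) * dpow D k := by
  ext r
  simp only [coeff_sum, coeff_const, coeff_pos, coeff_mul_dpow]
  split_ifs with h
  · obtain ⟨r, rfl⟩ := Int.eq_ofNat_of_zero_le h
    by_cases hr : r < K
    · rw [Finset.sum_eq_single r]
      · rw [sub_self, if_pos rfl]; congr 1; ring
      · intro b _ hb
        rw [if_neg (by omega)]
      · simp [hr]
    · rw [hM _ (by omega), Finset.sum_eq_zero]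
      intro k hk
      rw [Finset.mem_range] at hk
      rw [if_neg (by omega)]
  · symm
    refine Finset.sum_eq_zero fun k _ => ?_
    rw [if_neg (by omega)]

variable {W : Type*} [CommRing W] [Algebra F W] {E : Derivation F W W} {φ : V →ₐ[F] W}

/-- A non-zero term has `m + k + 1 ≤ N` in the first sum and `m + k + 1 ≤ M` in the second, so `K`
truncates both expansions. -/
theorem adlerCoeff_eq_sum (P Q : PseudoDiffOp D) {M N : ℤ} (hM : ∀ n, M < n → P.coeff n = 0)
    (hN : ∀ n, N < n → Q.coeff n = 0) (m n : ℤ) (K : ℕ) (hK : N - m ≤ K) (hK' : M - m ≤ K) :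
    adlerCoeff P Q m n =
      (∑ k ∈ Finset.range K, ∑ p ∈ Finset.Icc (m + 1) N, ∑ q ∈ Finset.Icc (n - K) M,
        C (P.coeff q) * powCoeff (lambdaAdd D) (q + k) n
          (powCoeff (-lambdaAdd D) p (m + k + 1) (C (Q.coeff p)))) -
      ∑ k ∈ Finset.range K, ∑ p ∈ Finset.Icc (n - K) N,
        C (P.coeff (m + k + 1)) * powCoeff (lambdaAdd D) k (n - p) (C (Q.coeff p)) := by
  unfold adlerCoeff
  congr 1
  · rw [finsum_eq_sum_of_support_subset
      (s := Finset.range K ×ˢ Finset.Icc (m + 1) N ×ˢ Finset.Icc (n - K) M), Finset.sum_product]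
    · simp_rw [Finset.sum_product]
    · rintro ⟨k, p, q⟩ ht
      rw [Function.mem_support] at ht
      by_contra hn
      apply ht
      simp only [Finset.coe_product, Finset.coe_range, Finset.coe_Icc, Set.mem_prod, Set.mem_Iio,
        Set.mem_Icc] at hn
      dsimp only
      by_cases h1 : M < q
      · simp [hM _ h1]
      by_cases h2 : N < p
      · simp [hN _ h2]
      by_cases h3 : p < m + k + 1
      · simp [powCoeff_of_lt _ _ _ h3]
      rw [powCoeff_of_lt _ (q + k) n (by omega)]
      simp
  · rw [finsum_eq_sum_of_support_subset
      (s := Finset.range K ×ˢ Finset.Icc (n - K) N), Finset.sum_product]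
    rintro ⟨k, p⟩ ht
    rw [Function.mem_support] at ht
    by_contra hn
    apply ht
    simp only [Finset.coe_product, Finset.coe_range, Finset.coe_Icc, Set.mem_prod, Set.mem_Iio,
      Set.mem_Icc] at hn
    dsimp only
    by_cases h1 : M < m + k + 1
    · simp [hM _ h1]
    by_cases h2 : N < p
    · simp [hN _ h2]
    rw [powCoeff_of_lt _ (k : ℤ) (n - p) (by omega)]
    simp

/-- The Adler identity in operator form. -/
theorem jetEval_adlerCoeff (hφ : ∀ v, φ (D v) = E (φ v)) (P Q : PseudoDiffOp D) (m n : ℤ) (f : W) :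
    jetEval E φ f (adlerCoeff P Q m n) =
      (mapHom φ hφ P * (dpow E (-1 - m) * const E f * mapHom φ hφ Q).pos -
        (mapHom φ hφ P * (dpow E (-1 - m) * const E f)).pos * mapHom φ hφ Q).coeff n := by
  obtain ⟨M, hM⟩ := P.exists_bound
  obtain ⟨N, hN⟩ := Q.exists_bound
  have hM' : ∀ n, M < n → (mapHom φ hφ P).coeff n = 0 := fun n hn => by simp [hM n hn]
  have hN' : ∀ n, N < n → (mapHom φ hφ Q).coeff n = 0 := fun n hn => by simp [hN n hn]
  obtain ⟨K, hK, hK'⟩ : ∃ K : ℕ, N - m ≤ K ∧ M - m ≤ K :=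
    ⟨max (N - m).toNat (M - m).toNat, by omega, by omega⟩
  have hL : ∀ q : V[X], jetEval E φ f (lambdaAdd D q) = (E : Module.End F W) (jetEval E φ f q) :=
    jetEval_lambdaAdd hφ f
  have hL' : ∀ q : V[X], jetEval E φ f ((-lambdaAdd D) q) =
      (-(E : Module.End F W)) (jetEval E φ f q) := fun q => by
    rw [LinearMap.neg_apply, map_neg, hL]; rfl
  rw [adlerCoeff_eq_sum P Q hM hN m n K hK hK', coeff_sub, map_sub]
  congr 1
  · rw [pos_dpow_mul_const_mul _ f m hN' K hK]
    simp only [Finset.mul_sum, coeff_sum, map_sum]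
    refine Finset.sum_congr rfl fun k hk => Finset.sum_congr rfl fun p _ => ?_
    rw [Finset.mem_range] at hk
    rw [coeff_mul_dpow_mul_const _ _ hM' k n (Finset.Icc (n - K) M)
      (fun q _ _ => Finset.mem_Icc.2 (by omega))]
    refine Finset.sum_congr rfl fun q _ => ?_
    rw [jetEval_C_mul, map_powCoeff _ _ _ hL, map_powCoeff _ _ _ hL', jetEval_C]
    rfl
  · rw [← mul_assoc, pos_mul_const, pos_mul_dpow _ m hM' K hK', Finset.sum_mul, Finset.sum_mul]
    simp only [coeff_sum, map_sum, mul_assoc, coeff_const_mul]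
    refine Finset.sum_congr rfl fun k hk => ?_
    rw [Finset.mem_range] at hk
    rw [coeff_dpow_mul _ _ (N := N) (fun n hn => by rw [coeff_const_mul, hN' n hn, mul_zero]) n
      (Finset.Icc (n - K) N) (fun q _ _ => Finset.mem_Icc.2 (by omega)), Finset.mul_sum]
    refine Finset.sum_congr rfl fun p _ => ?_
    rw [jetEval_C_mul, map_powCoeff _ _ _ hL, jetEval_C, coeff_const_mul, mul_comm f]
    rfl

end PseudoDiffOp

/-! ### The jet algebra

The differential algebra obtained from `V` by freely adjoining three differential indeterminates,
which serve as generic test functions. -/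

section Jets

variable {F : Type*} [Field F] {V : Type*} [CommRing V] [Algebra F V]

/-- The differential polynomials over `V` in three indeterminates; `X (i, n)` is the `n`-th
derivative of the `i`-th one. -/
abbrev JetAlgebra (V : Type*) [CommRing V] : Type _ := MvPolynomial (Fin 3 × ℕ) V

/-- The inclusion of the coefficients. -/
noncomputable def jetC (F V : Type*) [Field F] [CommRing V] [Algebra F V] : V →ₐ[F] JetAlgebra V :=
  IsScalarTower.toAlgHom F V (JetAlgebra V)

@[simp] theorem jetC_apply (v : V) : jetC F V v = MvPolynomial.C v := rfl

theorem jetAlgebra_derivation_ext {δ δ' : Derivation F (JetAlgebra V) (JetAlgebra V)}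
    (hC : ∀ v, δ (MvPolynomial.C v) = δ' (MvPolynomial.C v))
    (hX : ∀ i, δ (MvPolynomial.X i) = δ' (MvPolynomial.X i)) (w : JetAlgebra V) : δ w = δ' w := by
  induction w using MvPolynomial.induction_on with
  | C a => exact hC a
  | add p q hp hq => rw [map_add, map_add, hp, hq]
  | mul_X p i hp => rw [δ.leibniz, δ'.leibniz, hp, hX]

/-- The linear map `∑ c_m X ^ m ↦ ∑ δ(c_m) X ^ m` on the jet algebra. -/
noncomputable def extendLin (δ : V →ₗ[F] JetAlgebra V) : JetAlgebra V →ₗ[F] JetAlgebra V :=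
  (Finsupp.lsum F fun m : Fin 3 × ℕ →₀ ℕ =>
    LinearMap.mulRight F (MvPolynomial.monomial m (1 : V)) ∘ₗ δ) ∘ₗ
    (AddMonoidAlgebra.coeffLinearEquiv F).toLinearMap

theorem extendLin_monomial (δ : V →ₗ[F] JetAlgebra V) (m : Fin 3 × ℕ →₀ ℕ) (a : V) :
    extendLin δ (MvPolynomial.monomial m a) = δ a * MvPolynomial.monomial m 1 :=
  MvPolynomial.sum_monomial_eq (map_zero _)

/-- The derivation of the jet algebra that extends `δ : V → JetAlgebra V` on the coefficients
and kills the jet variables. -/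
noncomputable def extendDer (δ : V →ₗ[F] JetAlgebra V)
    (hδ : ∀ a b, δ (a * b) = MvPolynomial.C a * δ b + MvPolynomial.C b * δ a) :
    Derivation F (JetAlgebra V) (JetAlgebra V) :=
  Derivation.mk' (extendLin δ) fun p q => by
    induction p using MvPolynomial.induction_on' with
    | add p p' hp hp' =>
      simp only [add_mul, map_add, hp, hp', smul_eq_mul, mul_add]; ring
    | monomial m a =>
      induction q using MvPolynomial.induction_on' with
      | add q q' hq hq' =>
        simp only [mul_add, map_add, hq, hq', smul_eq_mul, add_mul]; ring
      | monomial n b =>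
        have h1 : ∀ (m : Fin 3 × ℕ →₀ ℕ) (a : V),
            MvPolynomial.monomial m a = MvPolynomial.C a * MvPolynomial.monomial m 1 :=
          fun m a => by rw [MvPolynomial.C_mul_monomial, mul_one]
        have h2 : MvPolynomial.monomial (m + n) (1 : V) =
            MvPolynomial.monomial m 1 * MvPolynomial.monomial n 1 := by
          rw [MvPolynomial.monomial_mul, mul_one]
        rw [MvPolynomial.monomial_mul, extendLin_monomial, extendLin_monomial, extendLin_monomial,
          hδ, smul_eq_mul, smul_eq_mul, h1 m a, h1 n b, h2]
        ring

theorem extendDer_C (δ : V →ₗ[F] JetAlgebra V)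
    (hδ : ∀ a b, δ (a * b) = MvPolynomial.C a * δ b + MvPolynomial.C b * δ a) (v : V) :
    extendDer δ hδ (MvPolynomial.C v) = δ v :=
  (extendLin_monomial δ 0 v).trans (by simp)

theorem extendDer_X (δ : V →ₗ[F] JetAlgebra V)
    (hδ : ∀ a b, δ (a * b) = MvPolynomial.C a * δ b + MvPolynomial.C b * δ a) (i : Fin 3 × ℕ) :
    extendDer δ hδ (MvPolynomial.X i) = 0 := by
  have : δ 1 = 0 := by simpa using hδ 1 1
  exact (extendLin_monomial δ _ 1).trans (by simp [this])

theorem jetC_comp_leibniz (D : Derivation F V V) (a b : V) :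
    ((jetC F V).toLinearMap ∘ₗ (D : V →ₗ[F] V)) (a * b) =
      MvPolynomial.C a * ((jetC F V).toLinearMap ∘ₗ (D : V →ₗ[F] V)) b +
        MvPolynomial.C b * ((jetC F V).toLinearMap ∘ₗ (D : V →ₗ[F] V)) a := by
  simp only [LinearMap.comp_apply, Derivation.coeFn_coe, Derivation.leibniz, smul_eq_mul,
      AlgHom.toLinearMap_apply, jetC_apply, map_add, map_mul]

/-- The derivation `∂` of the jet algebra. -/
noncomputable def jetDer (D : Derivation F V V) : Derivation F (JetAlgebra V) (JetAlgebra V) :=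
  extendDer ((jetC F V).toLinearMap ∘ₗ (D : V →ₗ[F] V)) (jetC_comp_leibniz D) +
  (MvPolynomial.mkDerivation V fun i : Fin 3 × ℕ =>
    (MvPolynomial.X (i.1, i.2 + 1) : JetAlgebra V)).restrictScalars F

variable (D : Derivation F V V)

theorem jetDer_C (v : V) : jetDer D (MvPolynomial.C v) = MvPolynomial.C (D v) := by
  rw [jetDer, Derivation.add_apply, extendDer_C]
  simp [MvPolynomial.derivation_C]

theorem jetC_comm (v : V) : jetC F V (D v) = jetDer D (jetC F V v) := (jetDer_C D v).symm

theorem jetDer_X (i : Fin 3) (n : ℕ) :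
    jetDer D (MvPolynomial.X (i, n)) = MvPolynomial.X (i, n + 1) := by
  rw [jetDer, Derivation.add_apply, extendDer_X]
  simp [MvPolynomial.mkDerivation_X]

theorem jetDer_pow_X (i : Fin 3) (m n : ℕ) :
    ((jetDer D : Module.End F (JetAlgebra V)) ^ n) (MvPolynomial.X (i, m)) =
      MvPolynomial.X (i, m + n) := by
  induction n with
  | zero => simp
  | succ n ih =>
    rw [pow_succ', Module.End.mul_apply, ih]
    exact jetDer_X D _ _

/-- The commutator of two derivations is a derivation, so it is enough to test it on coefficients
and on jet variables; `∂` permits the latter because it maps jet variables to jet variables. -/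
theorem extendDer_comm (δ : V →ₗ[F] JetAlgebra V)
    (hδ : ∀ a b, δ (a * b) = MvPolynomial.C a * δ b + MvPolynomial.C b * δ a)
    (hD : ∀ v, δ (D v) = jetDer D (δ v)) (w : JetAlgebra V) :
    extendDer δ hδ (jetDer D w) = jetDer D (extendDer δ hδ w) := by
  have h := jetAlgebra_derivation_ext (δ := ⁅extendDer δ hδ, jetDer D⁆) (δ' := 0) (fun v => by
      rw [Derivation.commutator_apply, jetDer_C, extendDer_C, extendDer_C, hD, sub_self]; rfl)
    (fun i => by
      rw [Derivation.commutator_apply, jetDer_X, extendDer_X, extendDer_X, map_zero, sub_self]; rfl)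
    w
  rw [Derivation.commutator_apply] at h
  exact sub_eq_zero.1 h

/-- `∂/∂X_{(i,n)}` and `∂` commute up to a shift. -/
theorem pderiv_jetDer (i : Fin 3) (n : ℕ) (w : JetAlgebra V) :
    MvPolynomial.pderiv (i, n) (jetDer D w) = jetDer D (MvPolynomial.pderiv (i, n) w) +
      if n = 0 then 0 else MvPolynomial.pderiv (i, n - 1) w := by
  set P : ℕ → Derivation F (JetAlgebra V) (JetAlgebra V) :=
    fun n => (MvPolynomial.pderiv (i, n)).restrictScalars F
  have hX : ∀ n (j : Fin 3 × ℕ), P n (MvPolynomial.X j) = if j = (i, n) then 1 else 0 := by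
    intro n j
    refine (MvPolynomial.pderiv_X _ _).trans ?_
    simp only [Pi.single_apply]
  have h := jetAlgebra_derivation_ext (δ := ⁅P n, jetDer D⁆) (δ' := if n = 0 then 0 else P (n - 1))
    (fun v => by
      rw [Derivation.commutator_apply, jetDer_C]
      have : ∀ n v, P n (MvPolynomial.C v) = 0 := fun n v => MvPolynomial.pderiv_C
      rw [this, this]
      split_ifs <;> simp [this])
    (fun ⟨j, m⟩ => by
      rw [Derivation.commutator_apply, jetDer_X, hX, hX]
      have hz : jetDer D (if (j, m) = (i, n) then 1 else 0) = 0 := by split_ifs <;> simp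
      rw [hz, sub_zero]
      cases n with
      | zero => simp
      | succ n =>
        simp only [Nat.add_one_ne_zero, if_false, Nat.add_sub_cancel, hX, Prod.mk.injEq,
          Nat.add_right_cancel_iff]) w
  rw [Derivation.commutator_apply] at h
  have h2 : MvPolynomial.pderiv (i, n) (jetDer D w) = jetDer D (MvPolynomial.pderiv (i, n) w) +
      (if n = 0 then 0 else P (n - 1) : Derivation F (JetAlgebra V) (JetAlgebra V)) w := by
    rw [← h]; simp [P]
  rw [h2]
  congr 1
  split_ifs <;> rfl

/-- If the integral of `X (i, 0) * R` vanishes, where `R` does not involve the `i`-th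
indeterminate, then `R = 0`. -/
theorem eq_zero_of_integral_X_mul (i : Fin 3) (R : JetAlgebra V)
    (hR : ∀ n, MvPolynomial.pderiv (i, n) R = 0)
    (h : integralMap (jetDer D) (MvPolynomial.X (i, 0) * R) = 0) : R = 0 := by
  obtain ⟨w, hw⟩ := (Submodule.Quotient.mk_eq_zero _).1 h
  rw [Derivation.coeFn_coe] at hw
  -- Write `w_n` for the derivative of `w` in the variable `(i, n)`. Differentiating `∂w = X (i, 0)
  -- * R` gives `∂w_0 = R` and `∂w_{n+1} + w_n = 0`. As `w_n = 0` for large `n`, descending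
  -- recursion kills every `w_n`, hence `R`.
  have hP : ∀ n, MvPolynomial.pderiv (i, n) (jetDer D w) = if n = 0 then R else 0 := fun n => by
    rw [hw, Derivation.leibniz, hR, smul_zero, zero_add, MvPolynomial.pderiv_X]
    simp only [Pi.single_apply, Prod.mk.injEq, true_and, smul_eq_mul]
    rw [mul_ite, mul_one, mul_zero]
    exact if_congr eq_comm rfl rfl
  have h0 : ∀ n, MvPolynomial.pderiv (i, n) w = 0 := by
    obtain ⟨K, hK⟩ : ∃ K, ∀ n, K ≤ n → MvPolynomial.pderiv (i, n) w = 0 := by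
      refine ⟨(w.vars.image Prod.snd).sup id + 1, fun n hn =>
        MvPolynomial.pderiv_eq_zero_of_notMem_vars fun hmem => ?_⟩
      have := Finset.le_sup (f := id) (Finset.mem_image_of_mem Prod.snd hmem)
      simp only [id] at this
      omega
    have hdown : ∀ n, MvPolynomial.pderiv (i, n + 1) w = 0 → MvPolynomial.pderiv (i, n) w = 0 := by
      intro n hn
      have := hP (n + 1)
      rwa [pderiv_jetDer, hn, map_zero, zero_add, if_neg n.succ_ne_zero, if_neg n.succ_ne_zero,
        Nat.add_sub_cancel] at this
    intro n
    by_contra hne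
    have hall : ∀ k, MvPolynomial.pderiv (i, n + k) w ≠ 0 := by
      intro k
      induction k with
      | zero => exact hne
      | succ k ih => exact fun h => ih (hdown _ h)
    exact hall K (hK _ (by omega))
  have h1 := hP 0
  rw [pderiv_jetDer, h0] at h1
  simpa using h1.symm

end Jets

section VectorFields

variable {F : Type*} [Field F] {V : Type*} [CommRing V] [Algebra F V] {D : Derivation F V V}

/-! ### Hamiltonian vector fields on the jet algebra -/

/-- `p(∂) f` in the jet algebra. -/
noncomputable abbrev jetApply (D : Derivation F V V) (f : JetAlgebra V) : V[X] →ₗ[F] JetAlgebra V :=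
  jetEval (jetDer D) (jetC F V) f

/-- `p(∂)^* f` in the jet algebra. -/
noncomputable abbrev jetCoapply (D : Derivation F V V) (f : JetAlgebra V) :
    V[X] →ₗ[F] JetAlgebra V :=
  jetCoeval (jetDer D) (jetC F V) f

theorem jetApply_apply (f : JetAlgebra V) (p : V[X]) :
    jetApply D f p = p.sum fun n c =>
      MvPolynomial.C c * ((jetDer D : Module.End F (JetAlgebra V)) ^ n) f := rfl

theorem pderiv_jetApply_self (i : Fin 3) (n : ℕ) (p : V[X]) :
    MvPolynomial.pderiv (i, n) (jetApply D (MvPolynomial.X (i, 0)) p) =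
      MvPolynomial.C (p.coeff n) := by
  induction p using Polynomial.induction_on' with
  | add p q hp hq => rw [map_add, map_add, hp, hq, coeff_add, map_add]
  | monomial k a =>
    rw [jetEval_monomial, jetDer_pow_X, jetC_apply, MvPolynomial.pderiv_C_mul,
      MvPolynomial.pderiv_X, coeff_monomial, zero_add]
    by_cases h : k = n
    · subst h; simp
    · rw [if_neg h, Pi.single_eq_of_ne (by simpa using h)]; simp

theorem pderiv_jetApply_of_ne {i j : Fin 3} (h : i ≠ j) (n : ℕ) (p : V[X]) :
    MvPolynomial.pderiv (i, n) (jetApply D (MvPolynomial.X (j, 0)) p) = 0 := by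
  induction p using Polynomial.induction_on' with
  | add p q hp hq => rw [map_add, map_add, hp, hq, add_zero]
  | monomial k a =>
    rw [jetEval_monomial, jetDer_pow_X, jetC_apply, MvPolynomial.pderiv_C_mul,
      MvPolynomial.pderiv_X, Pi.single_eq_of_ne (by simp [h.symm])]
    simp

/-- The derivatives of an indeterminate are algebraically independent over `V`, so differentiating
in the variable `(i, n)` reads off `p_n`. -/
theorem jetApply_eq_zero {i : Fin 3} {p : V[X]}
    (h : jetApply D (MvPolynomial.X (i, 0)) p = 0) : p = 0 := by
  ext n
  have := pderiv_jetApply_self (D := D) i n p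
  rw [h, map_zero] at this
  exact (MvPolynomial.C_injective _ _ (by rw [← this, coeff_zero, map_zero]))

/-- The bidifferential expression `∑ p_{nm} f_i^{(m)} f_j^{(n)}` with coefficients
`p = ∑ p_{nm} λ ^ m μ ^ n`. -/
noncomputable def jetApply₂ (D : Derivation F V V) (i j : Fin 3) : V[X][X] →ₗ[F] JetAlgebra V :=
  Polynomial.lsum fun n =>
    LinearMap.mulRight F (MvPolynomial.X (j, n)) ∘ₗ jetApply D (MvPolynomial.X (i, 0))

theorem jetApply₂_monomial (i j : Fin 3) (n : ℕ) (q : V[X]) :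
    jetApply₂ D i j (monomial n q) =
      jetApply D (MvPolynomial.X (i, 0)) q * MvPolynomial.X (j, n) := by
  simp [jetApply₂, Polynomial.lsum_apply]

theorem pderiv_jetApply₂_self {i j : Fin 3} (h : j ≠ i) (n : ℕ) (p : V[X][X]) :
    MvPolynomial.pderiv (j, n) (jetApply₂ D i j p) =
      jetApply D (MvPolynomial.X (i, 0)) (p.coeff n) := by
  induction p using Polynomial.induction_on' with
  | add p q hp hq => rw [map_add, map_add, hp, hq, coeff_add, map_add]
  | monomial k q =>
    rw [jetApply₂_monomial, Derivation.leibniz, pderiv_jetApply_of_ne h, MvPolynomial.pderiv_X,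
      coeff_monomial]
    by_cases hk : k = n
    · subst hk; simp
    · rw [if_neg hk, Pi.single_eq_of_ne (by simpa using hk)]; simp

theorem pderiv_jetApply₂_of_ne {i j k : Fin 3} (hi : k ≠ i) (hj : k ≠ j) (n : ℕ) (p : V[X][X]) :
    MvPolynomial.pderiv (k, n) (jetApply₂ D i j p) = 0 := by
  induction p using Polynomial.induction_on' with
  | add p q hp hq => rw [map_add, map_add, hp, hq, add_zero]
  | monomial m q =>
    rw [jetApply₂_monomial, Derivation.leibniz, pderiv_jetApply_of_ne hi, MvPolynomial.pderiv_X,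
      Pi.single_eq_of_ne (by simp [hj.symm])]
    simp

theorem jetApply₂_eq_zero {i j : Fin 3} (hij : j ≠ i) {p : V[X][X]}
    (h : jetApply₂ D i j p = 0) : p = 0 := by
  ext1 n
  have := pderiv_jetApply₂_self (D := D) hij n p
  rw [h, map_zero] at this
  exact jetApply_eq_zero this.symm

/-- By the product rule, `λ + μ` acts as `∂` on a product of the two test functions; this handles
the outer bracket in `{{a_λ b}_{λ+μ} c}`. -/
theorem jetApply₂_shift (i j : Fin 3) (s : V) (k m n : ℕ) :
    jetApply₂ D i j (C (C s * X ^ m) * X ^ n * (C X + X) ^ k) =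
      MvPolynomial.C s * ((jetDer D : Module.End F (JetAlgebra V)) ^ k)
        (MvPolynomial.X (i, m) * MvPolynomial.X (j, n)) := by
  induction k generalizing m n with
  | zero =>
    rw [pow_zero, mul_one, C_mul_X_pow_eq_monomial, jetApply₂_monomial, C_mul_X_pow_eq_monomial,
      jetEval_monomial, jetDer_pow_X]
    simp [mul_assoc]
  | succ k ih =>
    have h : (C (C s * X ^ m) * X ^ n * (C X + X) ^ (k + 1) : V[X][X]) =
        C (C s * X ^ (m + 1)) * X ^ n * (C X + X) ^ k +
          C (C s * X ^ m) * X ^ (n + 1) * (C X + X) ^ k := by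
      simp only [map_mul, map_pow]; ring
    rw [h, map_add, ih, ih, ← mul_add, ← map_add, pow_succ (jetDer D : Module.End F (JetAlgebra V)),
      Module.End.mul_apply]
    simp only [Derivation.coeFn_coe, Derivation.leibniz, jetDer_X, smul_eq_mul]
    congr 2
    ring

namespace LambdaBracket

variable (L : LambdaBracket D)

theorem jetApply_br_leibniz (a : V) (f : JetAlgebra V) (b c : V) :
    (jetApply D f ∘ₗ L.br a) (b * c) =
      MvPolynomial.C b * (jetApply D f ∘ₗ L.br a) c +
        MvPolynomial.C c * (jetApply D f ∘ₗ L.br a) b := by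
  simp only [LinearMap.comp_apply, L.leibniz_right, map_add, jetEval_C_mul, jetC_apply]
  ring

theorem jetCoapply_br_leibniz (u : V) (f : JetAlgebra V) (b c : V) :
    (jetCoapply D f ∘ₗ L.br.flip u) (b * c) =
      MvPolynomial.C b * (jetCoapply D f ∘ₗ L.br.flip u) c +
        MvPolynomial.C c * (jetCoapply D f ∘ₗ L.br.flip u) b := by
  simp only [LinearMap.comp_apply, LinearMap.flip_apply, L.leibniz_left, map_add,
    jetCoeval_shiftApply (jetC_comm D), jetC_apply]
  ring

/-- The vector field `v ↦ {a_∂ v} f` with Hamiltonian `∫ a f`. -/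
noncomputable def hamDer (a : V) (f : JetAlgebra V) : Derivation F (JetAlgebra V) (JetAlgebra V) :=
  extendDer (jetApply D f ∘ₗ L.br a) (L.jetApply_br_leibniz a f)

/-- The derivation `a ↦ {a_∂ u}^* f`. -/
noncomputable def cohamDer (u : V) (f : JetAlgebra V) :
    Derivation F (JetAlgebra V) (JetAlgebra V) :=
  extendDer (jetCoapply D f ∘ₗ L.br.flip u) (L.jetCoapply_br_leibniz u f)

theorem hamDer_C (a : V) (f : JetAlgebra V) (v : V) :
    L.hamDer a f (MvPolynomial.C v) = jetApply D f (L.br a v) := extendDer_C _ _ _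

theorem hamDer_X (a : V) (f : JetAlgebra V) (i : Fin 3 × ℕ) :
    L.hamDer a f (MvPolynomial.X i) = 0 := extendDer_X _ _ _

theorem hamDer_comm (a : V) (f w : JetAlgebra V) :
    L.hamDer a f (jetDer D w) = jetDer D (L.hamDer a f w) :=
  extendDer_comm D _ _ (fun v => by
    simp only [LinearMap.comp_apply, L.sesq_right, jetEval_lambdaAdd (jetC_comm D)]) w

theorem cohamDer_C (a : V) (f : JetAlgebra V) (v : V) :
    L.cohamDer a f (MvPolynomial.C v) = jetCoapply D f (L.br v a) := extendDer_C _ _ _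

theorem cohamDer_comm (a : V) (f w : JetAlgebra V) :
    L.cohamDer a f (jetDer D w) = jetDer D (L.cohamDer a f w) :=
  extendDer_comm D _ _ (fun v => by
    simp only [LinearMap.comp_apply, LinearMap.flip_apply, L.sesq_left, map_neg, jetCoeval_X_mul,
      neg_neg]) w

/-- Skewsymmetry of the bracket of two elements, tested on a generic function. -/
theorem skew_iff (a b : V) : L.br b a = -negShift D (L.br a b) ↔
    ∀ f, jetApply D f (L.br b a) = -jetCoapply D f (L.br a b) := by
  constructor
  · intro h f
    rw [h, map_neg, jetEval_negShift (jetC_comm D)]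
  · intro h
    rw [eq_neg_iff_add_eq_zero]
    refine jetApply_eq_zero (D := D) (i := 0) ?_
    rw [map_add, jetEval_negShift (jetC_comm D), h, neg_add_cancel]

theorem integral_derivation_eq_zero {δ : Derivation F (JetAlgebra V) (JetAlgebra V)}
    (hδ : ∀ w, δ (jetDer D w) = jetDer D (δ w)) {w : JetAlgebra V}
    (h : integralMap (jetDer D) w = 0) : integralMap (jetDer D) (δ w) = 0 := by
  obtain ⟨v, rfl⟩ := (Submodule.Quotient.mk_eq_zero _).1 h
  exact (Submodule.Quotient.mk_eq_zero _).2 ⟨δ v, (hδ v).symm⟩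

/-- The pairing `∫ g {a_∂ b} f + ∫ f {b_∂ a} g` vanishes for a skewsymmetric pair. -/
theorem integral_hamDer_skew {a b : V} (h : L.br b a = -negShift D (L.br a b))
    (f g : JetAlgebra V) :
    integralMap (jetDer D) (g * L.hamDer a f (MvPolynomial.C b) +
      f * L.hamDer b g (MvPolynomial.C a)) = 0 := by
  rw [map_add, hamDer_C, hamDer_C, (L.skew_iff a b).1 h, integral_mul_jetEval, mul_neg, map_neg,
    add_neg_cancel]

/-- The pairing in `integral_hamDer_skew` is symmetric in the two elements, and it determines the
bracket when the test functions are independent indeterminates. -/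
theorem skew_symm {a b : V} (h : L.br b a = -negShift D (L.br a b)) :
    L.br a b = -negShift D (L.br b a) := by
  rw [eq_neg_iff_add_eq_zero]
  refine jetApply_eq_zero (D := D) (i := 0) ?_
  refine eq_zero_of_integral_X_mul D 1 _ (fun n => pderiv_jetApply_of_ne (by decide) _ _) ?_
  have := L.integral_hamDer_skew h (MvPolynomial.X (0, 0)) (MvPolynomial.X (1, 0))
  rw [map_add, jetEval_negShift (jetC_comm D), mul_add, map_add]
  rw [map_add, hamDer_C, hamDer_C, integral_mul_jetEval _ _ (MvPolynomial.X (1, 0))] at this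
  exact this

/-- The vector field `c ↦ {{a_λ b}_{λ+μ} c}` tested on the `i`-th and `j`-th generic functions. -/
noncomputable def nestedDer (i j : Fin 3) (p : V[X]) :
    Derivation F (JetAlgebra V) (JetAlgebra V) :=
  ∑ n ∈ p.support, L.hamDer (p.coeff n) (MvPolynomial.X (i, n) * MvPolynomial.X (j, 0))

theorem nestedDer_apply (i j : Fin 3) (p : V[X]) (w : JetAlgebra V) :
    L.nestedDer i j p w =
      ∑ n ∈ p.support, L.hamDer (p.coeff n) (MvPolynomial.X (i, n) * MvPolynomial.X (j, 0)) w := by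
  simp only [nestedDer, ← Derivation.coeFnAddMonoidHom_apply, map_sum, Finset.sum_apply]

theorem nestedDer_comm (i j : Fin 3) (p : V[X]) (w : JetAlgebra V) :
    L.nestedDer i j p (jetDer D w) = jetDer D (L.nestedDer i j p w) := by
  simp only [nestedDer_apply, hamDer_comm, map_sum]

/-- The difference of the two sides of the Jacobi identity. -/
noncomputable def jacobiator (a b c : V) : V[X][X] :=
  ((L.br b c).sum fun n r => C (L.br a r) * (X : V[X][X]) ^ n) -
    ((L.br a c).sum fun n r => (L.br b r).map C * C (X ^ n)) -
    (L.br a b).sum fun n r => C (X ^ n) * (L.br r c).eval₂ (C.comp C) (C X + X)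

/-- Since `hamDer` kills the test functions, nested brackets are compositions of vector fields; the
Jacobi identity then says that a commutator of Hamiltonian fields is Hamiltonian. -/
theorem jetApply₂_jacobiator (i j : Fin 3) (a b c : V) :
    jetApply₂ D i j (L.jacobiator a b c) =
      (⁅L.hamDer a (MvPolynomial.X (i, 0)), L.hamDer b (MvPolynomial.X (j, 0))⁆ -
        L.nestedDer i j (L.br a b)) (MvPolynomial.C c) := by
  rw [Derivation.sub_apply, Derivation.commutator_apply, hamDer_C, hamDer_C, jacobiator, map_sub,
    map_sub]
  congr 1
  · congr 1
    · rw [jetApply_apply, Polynomial.sum, Polynomial.sum, map_sum, map_sum]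
      refine Finset.sum_congr rfl fun n _ => ?_
      rw [jetDer_pow_X, Derivation.leibniz, hamDer_X, smul_zero, zero_add, hamDer_C,
        C_mul_X_pow_eq_monomial, jetApply₂_monomial, zero_add, smul_eq_mul, mul_comm]
    · rw [jetApply_apply, Polynomial.sum, Polynomial.sum, map_sum, map_sum]
      refine Finset.sum_congr rfl fun n _ => ?_
      rw [jetDer_pow_X, Derivation.leibniz, hamDer_X, smul_zero, zero_add, hamDer_C, zero_add]
      induction L.br b ((L.br a c).coeff n) using Polynomial.induction_on' with
      | add p q hp hq => rw [Polynomial.map_add, add_mul, map_add, hp, hq, map_add, smul_add]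
      | monomial k s =>
        rw [map_monomial, mul_comm, C_mul_monomial, jetApply₂_monomial, mul_comm,
          X_pow_mul_C, C_mul_X_pow_eq_monomial, jetEval_monomial, jetEval_monomial,
          jetDer_pow_X, jetDer_pow_X]
        simp only [zero_add, jetC_apply, smul_eq_mul]
        ring
  · rw [nestedDer_apply, Polynomial.sum, map_sum]
    refine Finset.sum_congr rfl fun n _ => ?_
    rw [hamDer_C]
    induction L.br ((L.br a b).coeff n) c using Polynomial.induction_on' with
    | add p q hp hq => rw [eval₂_add, mul_add, map_add, hp, hq, map_add]
    | monomial k s =>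
      rw [eval₂_monomial, jetEval_monomial, jetC_apply, ← jetApply₂_shift]
      congr 1
      simp only [RingHom.comp_apply, map_mul]
      ring

/-- The cyclic form of the Jacobi identity, tested on three generic functions. -/
noncomputable def jacobiCycle (i j k : Fin 3) (a b c : V) : LocalFunctional (jetDer D) :=
  integralMap (jetDer D) (MvPolynomial.X (k, 0) * L.hamDer a (MvPolynomial.X (i, 0))
      (L.hamDer b (MvPolynomial.X (j, 0)) (MvPolynomial.C c))) +
    integralMap (jetDer D) (MvPolynomial.X (i, 0) * L.hamDer b (MvPolynomial.X (j, 0))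
      (L.hamDer c (MvPolynomial.X (k, 0)) (MvPolynomial.C a))) +
    integralMap (jetDer D) (MvPolynomial.X (j, 0) * L.hamDer c (MvPolynomial.X (k, 0))
      (L.hamDer a (MvPolynomial.X (i, 0)) (MvPolynomial.C b)))

theorem jacobiCycle_rotate (i j k : Fin 3) (a b c : V) :
    L.jacobiCycle i j k a b c = L.jacobiCycle j k i b c a := by
  unfold jacobiCycle; abel

/-- The first cyclic term is already present. The second comes from applying the field of `b` to the
vanishing pairing of `a` and `c`, the third from the skewsymmetry of `c` with each coefficient of
`{a_λ b}`. -/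
theorem integral_mul_jacobiator (i j k : Fin 3) {a b c : V}
    (hac : L.br c a = -negShift D (L.br a c))
    (hab : ∀ n, L.br c ((L.br a b).coeff n) = -negShift D (L.br ((L.br a b).coeff n) c)) :
    integralMap (jetDer D) (MvPolynomial.X (k, 0) * jetApply₂ D i j (L.jacobiator a b c)) =
      L.jacobiCycle i j k a b c := by
  rw [jetApply₂_jacobiator, Derivation.sub_apply, Derivation.commutator_apply, mul_sub, mul_sub,
    map_sub, map_sub, jacobiCycle]
  have h1 := integral_derivation_eq_zero (L.hamDer_comm b (MvPolynomial.X (j, 0)))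
    (L.integral_hamDer_skew hac (MvPolynomial.X (i, 0)) (MvPolynomial.X (k, 0)))
  simp only [map_add, Derivation.leibniz, hamDer_X, smul_eq_mul, mul_zero, add_zero] at h1
  have h2 : integralMap (jetDer D) (MvPolynomial.X (k, 0) *
      L.nestedDer i j (L.br a b) (MvPolynomial.C c)) =
      -integralMap (jetDer D) (MvPolynomial.X (j, 0) * L.hamDer c (MvPolynomial.X (k, 0))
      (L.hamDer a (MvPolynomial.X (i, 0)) (MvPolynomial.C b))) := by
    rw [hamDer_C, nestedDer_apply, jetApply_apply, Polynomial.sum, map_sum, Finset.mul_sum,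
      Finset.mul_sum, map_sum, map_sum, ← Finset.sum_neg_distrib]
    refine Finset.sum_congr rfl fun n _ => ?_
    rw [eq_neg_iff_add_eq_zero, ← map_add, jetDer_pow_X, Derivation.leibniz, hamDer_X, smul_zero,
      zero_add, zero_add, smul_eq_mul, ← mul_assoc, mul_comm (MvPolynomial.X (j, 0))]
    exact L.integral_hamDer_skew (hab n) _ _
  rw [h2, sub_neg_eq_add, eq_neg_of_add_eq_zero_left h1, sub_neg_eq_add]

end LambdaBracket

end VectorFields

/-! ### Extension from the coefficients of `A` to the differential subalgebra they generate. -/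

section Generation

variable {F : Type*} [Field F] {V : Type*} [CommRing V] [Algebra F V] {D : Derivation F V V} {N : ℕ}

theorem coeff_mem_coeffSubalgebra (A : Matrix (Fin N) (Fin N) (PseudoDiffOp D)) (i j : Fin N)
    (m : ℤ) : (A i j).coeff m ∈ coeffSubalgebra A :=
  Algebra.subset_adjoin ⟨i, j, m, 0, rfl⟩

theorem coeffSubalgebra_induction {A : Matrix (Fin N) (Fin N) (PseudoDiffOp D)} {p : V → Prop}
    (hC : ∀ r : F, p (algebraMap F V r)) (hA : ∀ i j m, p ((A i j).coeff m))
    (hD : ∀ v, p v → p (D v)) (hadd : ∀ u v, p u → p v → p (u + v))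
    (hmul : ∀ u v, p u → p v → p (u * v)) {v : V} (hv : v ∈ coeffSubalgebra A) : p v := by
  induction hv using Algebra.adjoin_induction with
  | mem x hx =>
    obtain ⟨i, j, m, r, rfl⟩ := hx
    induction r with
    | zero => exact hA i j m
    | succ r ih => rw [Function.iterate_succ_apply']; exact hD _ ih
  | algebraMap r => exact hC r
  | add x y _ _ hx hy => exact hadd x y hx hy
  | mul x y _ _ hx hy => exact hmul x y hx hy

theorem derivation_mem_coeffSubalgebra {A : Matrix (Fin N) (Fin N) (PseudoDiffOp D)} {v : V}
    (hv : v ∈ coeffSubalgebra A) : D v ∈ coeffSubalgebra A := by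
  induction hv using Algebra.adjoin_induction with
  | mem x hx =>
    obtain ⟨i, j, m, r, rfl⟩ := hx
    exact Algebra.subset_adjoin ⟨i, j, m, r + 1, (Function.iterate_succ_apply' _ _ _).symm⟩
  | algebraMap r => rw [D.map_algebraMap]; exact Subalgebra.zero_mem _
  | add x y _ _ hx hy => rw [map_add]; exact Subalgebra.add_mem _ hx hy
  | mul x y hx' hy' hx hy =>
    rw [D.leibniz]
    exact Subalgebra.add_mem _ (Subalgebra.mul_mem _ hx' hy) (Subalgebra.mul_mem _ hy' hx)

theorem coeffSubalgebra_add_const_le (A : Matrix (Fin N) (Fin N) (PseudoDiffOp D)) (ε : F) :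
    coeffSubalgebra (A + Matrix.diagonal fun _ => PseudoDiffOp.const D (algebraMap F V ε)) ≤
      coeffSubalgebra A := by
  intro v hv
  refine coeffSubalgebra_induction (fun r => Subalgebra.algebraMap_mem _ r) (fun i j m => ?_)
    (fun v => derivation_mem_coeffSubalgebra) (fun _ _ => Subalgebra.add_mem _)
    (fun _ _ => Subalgebra.mul_mem _) hv
  rw [Matrix.add_apply, PseudoDiffOp.coeff_add]
  refine Subalgebra.add_mem _ (coeff_mem_coeffSubalgebra A i j m) ?_
  rw [Matrix.diagonal_apply]
  split_ifs
  · rw [PseudoDiffOp.coeff_const]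
    split_ifs
    · exact Subalgebra.algebraMap_mem _ _
    · exact Subalgebra.zero_mem _
  · exact Subalgebra.zero_mem _

theorem coeffSubalgebra_add_const (A : Matrix (Fin N) (Fin N) (PseudoDiffOp D)) (ε : F) :
    coeffSubalgebra (A + Matrix.diagonal fun _ => PseudoDiffOp.const D (algebraMap F V ε)) =
      coeffSubalgebra A := by
  refine le_antisymm (coeffSubalgebra_add_const_le A ε) ?_
  -- The reverse inclusion is the first one for `A + ε` and the constant `-ε`.
  have h := coeffSubalgebra_add_const_le
    (A + Matrix.diagonal fun _ => PseudoDiffOp.const D (algebraMap F V ε)) (-ε)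
  convert h using 2
  ext i j n
  simp only [Matrix.add_apply, Matrix.diagonal_apply, PseudoDiffOp.coeff_add]
  split_ifs
  · simp only [PseudoDiffOp.coeff_const, map_neg]
    split_ifs <;> simp
  · simp

/-- Two derivations of the jet algebra that commute with `∂` and agree on the coefficients of `A`
agree on the differential subalgebra generated by them. -/
theorem derivation_eq_on_coeffSubalgebra {A : Matrix (Fin N) (Fin N) (PseudoDiffOp D)}
    {δ δ' : Derivation F (JetAlgebra V) (JetAlgebra V)}
    (hδ : ∀ w, δ (jetDer D w) = jetDer D (δ w)) (hδ' : ∀ w, δ' (jetDer D w) = jetDer D (δ' w))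
    (h : ∀ i j m, δ (MvPolynomial.C ((A i j).coeff m)) = δ' (MvPolynomial.C ((A i j).coeff m)))
    {v : V} (hv : v ∈ coeffSubalgebra A) : δ (MvPolynomial.C v) = δ' (MvPolynomial.C v) := by
  refine coeffSubalgebra_induction (p := fun v => δ (MvPolynomial.C v) = δ' (MvPolynomial.C v))
    (fun r => ?_) h (fun v hv => ?_) (fun u v hu hv => ?_) (fun u v hu hv => ?_) hv
  · have : (MvPolynomial.C (algebraMap F V r) : JetAlgebra V) = algebraMap F _ r := rfl
    rw [this, Derivation.map_algebraMap, Derivation.map_algebraMap]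
  · rw [← jetDer_C, hδ, hδ', hv]
  · rw [map_add, map_add, map_add, hu, hv]
  · rw [map_mul, δ.leibniz, δ'.leibniz, hu, hv]

/-- The polynomials with all coefficients in a subalgebra. -/
def coeffsIn (S : Subalgebra F V) : Submodule F V[X] where
  carrier := {p | ∀ n, p.coeff n ∈ S}
  zero_mem' n := by simp
  add_mem' hp hq n := by rw [coeff_add]; exact S.add_mem (hp n) (hq n)
  smul_mem' r p hp n := by rw [coeff_smul]; exact S.smul_mem (hp n) r

theorem C_mul_mem_coeffsIn {S : Subalgebra F V} {a : V} (ha : a ∈ S) {p : V[X]}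
    (hp : p ∈ coeffsIn S) : C a * p ∈ coeffsIn S := fun n => by
  rw [coeff_C_mul]; exact S.mul_mem ha (hp n)

theorem C_mem_coeffsIn {S : Subalgebra F V} {a : V} (ha : a ∈ S) : C a ∈ coeffsIn S := fun n => by
  rw [coeff_C]; split_ifs; exacts [ha, S.zero_mem]

theorem X_mul_mem_coeffsIn {S : Subalgebra F V} {p : V[X]} (hp : p ∈ coeffsIn S) :
    X * p ∈ coeffsIn S := by
  rintro (_ | n)
  · simp
  · rw [coeff_X_mul]; exact hp n

theorem lambdaAdd_mem_coeffsIn {S : Subalgebra F V} (hS : ∀ v ∈ S, D v ∈ S) {p : V[X]}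
    (hp : p ∈ coeffsIn S) : lambdaAdd D p ∈ coeffsIn S := fun n => by
  rw [coeff_lambdaAdd]
  exact S.add_mem (X_mul_mem_coeffsIn hp n) (hS _ (hp n))

theorem pow_apply_mem {M : Type*} [AddCommGroup M] [Module F M] {P : Submodule F M}
    {T : Module.End F M} (hT : ∀ x ∈ P, T x ∈ P) (n : ℕ) {x : M} (hx : x ∈ P) : (T ^ n) x ∈ P := by
  induction n with
  | zero => exact hx
  | succ n ih => rw [pow_succ', Module.End.mul_apply]; exact hT _ ih

theorem powCoeff_apply_mem {M : Type*} [AddCommGroup M] [Module F M] {P : Submodule F M}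
    {T : Module.End F M} (hT : ∀ x ∈ P, T x ∈ P) (q s : ℤ) {x : M} (hx : x ∈ P) :
    powCoeff T q s x ∈ P := by
  unfold powCoeff
  split_ifs
  · exact zsmul_mem (pow_apply_mem hT _ hx) _
  · exact P.zero_mem

theorem shiftApply_mem_coeffsIn {S : Subalgebra F V} (hS : ∀ v ∈ S, D v ∈ S) {p : V[X]}
    (hp : p ∈ coeffsIn S) {b : V} (hb : b ∈ S) : shiftApply D p b ∈ coeffsIn S :=
  Submodule.sum_mem _ fun n _ => C_mul_mem_coeffsIn (hp n)
    (pow_apply_mem (fun _ => lambdaAdd_mem_coeffsIn hS) n (C_mem_coeffsIn hb))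

theorem adlerCoeff_mem_coeffsIn {S : Subalgebra F V} (hS : ∀ v ∈ S, D v ∈ S) {P Q : PseudoDiffOp D}
    (hP : ∀ n, P.coeff n ∈ S) (hQ : ∀ n, Q.coeff n ∈ S) (m n : ℤ) :
    adlerCoeff P Q m n ∈ coeffsIn S := by
  have h1 : ∀ p ∈ coeffsIn S, lambdaAdd D p ∈ coeffsIn S := fun _ => lambdaAdd_mem_coeffsIn hS
  have h2 : ∀ p ∈ coeffsIn S, (-lambdaAdd D) p ∈ coeffsIn S := fun p hp =>
    neg_mem (lambdaAdd_mem_coeffsIn hS hp)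
  refine sub_mem ?_ ?_
  · exact finsum_induction (· ∈ coeffsIn S) (Submodule.zero_mem _)
      (fun _ _ => Submodule.add_mem _) fun t =>
        C_mul_mem_coeffsIn (hP _) (powCoeff_apply_mem h1 _ _
          (powCoeff_apply_mem h2 _ _ (C_mem_coeffsIn (hQ _))))
  · exact finsum_induction (· ∈ coeffsIn S) (Submodule.zero_mem _)
      (fun _ _ => Submodule.add_mem _) fun t =>
        C_mul_mem_coeffsIn (hP _) (powCoeff_apply_mem h1 _ _ (C_mem_coeffsIn (hQ _)))

theorem shiftApply_one (D : Derivation F V V) (p : V[X]) : shiftApply D p 1 = p := by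
  induction p using Polynomial.induction_on' with
  | add p q hp hq => rw [shiftApply_add, hp, hq]
  | monomial n a =>
    have h : (lambdaAdd D ^ n) (C 1) = X ^ n := by
      induction n with
      | zero => simp
      | succ n ih =>
        rw [pow_succ', Module.End.mul_apply, ih, X_pow_eq_monomial, lambdaAdd_monomial,
          X_pow_eq_monomial]
        simp
    rw [shiftApply, sum_monomial_index _ _ (by simp), h, C_mul_X_pow_eq_monomial]

end Generation

/-! ### Adler type operators generate Poisson vertex algebras -/

namespace LambdaBracket

open PseudoDiffOp

variable {F : Type*} [Field F] {V : Type*} [CommRing V] [Algebra F V] {D : Derivation F V V} {N : ℕ}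
  (L : LambdaBracket D) {A : Matrix (Fin N) (Fin N) (PseudoDiffOp D)}

theorem br_algebraMap_left (r : F) (b : V) : L.br (algebraMap F V r) b = 0 := by
  have h1 : L.br 1 b = 0 := by
    have h := L.leibniz_left 1 1 b
    rw [mul_one, shiftApply_one] at h
    exact left_eq_add.1 h
  rw [Algebra.algebraMap_eq_smul_one, map_smul, LinearMap.smul_apply, h1, smul_zero]

theorem br_algebraMap_right (r : F) (a : V) : L.br a (algebraMap F V r) = 0 := by
  have h1 : L.br a 1 = 0 := by
    have h := L.leibniz_right a 1 1
    rw [mul_one, C_1, one_mul] at h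
    exact left_eq_add.1 h
  rw [Algebra.algebraMap_eq_smul_one, map_smul, h1, smul_zero]

/-- The operator `A` over the jet algebra. -/
noncomputable abbrev jetMatrix (A : Matrix (Fin N) (Fin N) (PseudoDiffOp D)) :
    Matrix (Fin N) (Fin N) (PseudoDiffOp (jetDer D)) :=
  (mapHom (jetC F V) (jetC_comm D)).mapMatrix A

theorem coeff_jetMatrix (A : Matrix (Fin N) (Fin N) (PseudoDiffOp D)) (i j : Fin N) (m : ℤ) :
    (jetMatrix A i j).coeff m = MvPolynomial.C ((A i j).coeff m) := rfl

variable {L}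

/-- The Hamiltonian vector field of a coefficient of an Adler type operator. -/
theorem matrixDer_hamDer_of_isAdlerType (hA : IsAdlerType L A) (i j : Fin N) (m : ℤ)
    (f : JetAlgebra V) :
    matrixDer (L.hamDer ((A i j).coeff m) f) N (jetMatrix A) =
      (matrixSplitting (jetDer D) N).adler (jetMatrix A) (jetMatrix A) (testOp j i m f) := by
  ext h k n
  rw [adler_testOp_apply, matrixDer_apply, coeff_mapDer, coeff_jetMatrix, hamDer_C, hA,
    jetEval_adlerCoeff (jetC_comm D)]
  rfl

/-- Integrated against a second test function, each bracket becomes the trace of an Adler map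
against a test operator, and `tr_adler_skew` applies. -/
theorem skew_coeff_of_isAdlerType (hA : IsAdlerType L A) (i j h k : Fin N) (m n : ℤ) :
    L.br ((A h k).coeff n) ((A i j).coeff m) =
      -negShift D (L.br ((A i j).coeff m) ((A h k).coeff n)) := by
  rw [eq_neg_iff_add_eq_zero]
  refine jetApply_eq_zero (D := D) (i := 0) ?_
  refine eq_zero_of_integral_X_mul D 1 _ (fun n => pderiv_jetApply_of_ne (by decide) _ _) ?_
  rw [map_add, jetEval_negShift (jetC_comm D), mul_add, map_add,
    ← integral_mul_jetEval _ _ (MvPolynomial.X (1, 0)) (MvPolynomial.X (0, 0)), ← hamDer_C,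
    ← hamDer_C, ← coeff_jetMatrix, ← coeff_jetMatrix, ← coeff_mapDer, ← coeff_mapDer,
    ← matrixDer_apply, ← matrixDer_apply,
    matrixDer_hamDer_of_isAdlerType hA, matrixDer_hamDer_of_isAdlerType hA, ← tr_mul_testOp,
    ← tr_mul_testOp]
  exact TracedSplitting.tr_adler_skew _ _ _ _ _

theorem br_mem_coeffsIn_of_isAdlerType (hA : IsAdlerType L A) {a b : V}
    (ha : a ∈ coeffSubalgebra A) (hb : b ∈ coeffSubalgebra A) :
    L.br a b ∈ coeffsIn (coeffSubalgebra A) := by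
  have hS : ∀ v ∈ coeffSubalgebra A, D v ∈ coeffSubalgebra A := fun _ =>
    derivation_mem_coeffSubalgebra
  have h1 : ∀ i j m, ∀ b ∈ coeffSubalgebra A,
      L.br ((A i j).coeff m) b ∈ coeffsIn (coeffSubalgebra A) := by
    intro i j m b hb
    -- Membership of `b` is carried along because the Leibniz rule multiplies brackets by the
    -- factors themselves.
    refine (coeffSubalgebra_induction (p := fun b => b ∈ coeffSubalgebra A ∧
      L.br ((A i j).coeff m) b ∈ coeffsIn (coeffSubalgebra A)) (fun r => ?_) (fun h k n => ?_)
      (fun v hv => ?_) (fun u v hu hv => ?_) (fun u v hu hv => ?_) hb).2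
    · rw [br_algebraMap_right]
      exact ⟨Subalgebra.algebraMap_mem _ _, Submodule.zero_mem _⟩
    · rw [hA]
      exact ⟨coeff_mem_coeffSubalgebra A h k n, adlerCoeff_mem_coeffsIn hS
        (coeff_mem_coeffSubalgebra A _ _) (coeff_mem_coeffSubalgebra A _ _) _ _⟩
    · rw [L.sesq_right]
      exact ⟨hS _ hv.1, lambdaAdd_mem_coeffsIn hS hv.2⟩
    · rw [map_add]
      exact ⟨Subalgebra.add_mem _ hu.1 hv.1, Submodule.add_mem _ hu.2 hv.2⟩
    · rw [L.leibniz_right, mul_comm u]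
      exact ⟨Subalgebra.mul_mem _ hv.1 hu.1, Submodule.add_mem _ (C_mul_mem_coeffsIn hv.1 hu.2)
        (C_mul_mem_coeffsIn hu.1 hv.2)⟩
  refine (coeffSubalgebra_induction (p := fun a => a ∈ coeffSubalgebra A ∧
      L.br a b ∈ coeffsIn (coeffSubalgebra A)) (fun r => ?_) (fun h k n => ?_)
      (fun v hv => ?_) (fun u v hu hv => ?_) (fun u v hu hv => ?_) ha).2
  · rw [br_algebraMap_left]
    exact ⟨Subalgebra.algebraMap_mem _ _, Submodule.zero_mem _⟩
  · exact ⟨coeff_mem_coeffSubalgebra A h k n, h1 _ _ _ _ hb⟩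
  · rw [L.sesq_left]
    exact ⟨hS _ hv.1, neg_mem (X_mul_mem_coeffsIn hv.2)⟩
  · rw [map_add, LinearMap.add_apply]
    exact ⟨Subalgebra.add_mem _ hu.1 hv.1, Submodule.add_mem _ hu.2 hv.2⟩
  · rw [L.leibniz_left]
    exact ⟨Subalgebra.mul_mem _ hu.1 hv.1, Submodule.add_mem _
      (shiftApply_mem_coeffsIn hS hu.2 hv.1) (shiftApply_mem_coeffsIn hS hv.2 hu.1)⟩

/-- For fixed `a` and `f`, both `v ↦ {a_∂ v} f` and `v ↦ -{v_∂ a}^* f` are derivations commuting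
with `∂`, so agreement on the coefficients of `A` suffices. -/
theorem skew_extend {a : V} (h : ∀ i j m, L.br ((A i j).coeff m) a =
      -negShift D (L.br a ((A i j).coeff m))) {b : V} (hb : b ∈ coeffSubalgebra A) :
    L.br b a = -negShift D (L.br a b) := by
  refine L.skew_symm ((L.skew_iff b a).2 fun f => ?_)
  rw [← hamDer_C, ← cohamDer_C, ← Derivation.neg_apply]
  refine derivation_eq_on_coeffSubalgebra (L.hamDer_comm a f) (fun w => ?_) (fun i j m => ?_) hb
  · rw [Derivation.neg_apply, Derivation.neg_apply, cohamDer_comm, map_neg]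
  · rw [Derivation.neg_apply, hamDer_C, cohamDer_C]
    exact (L.skew_iff _ _).1 (L.skew_symm (h i j m)) f

theorem skew_of_isAdlerType (hA : IsAdlerType L A) {a b : V} (ha : a ∈ coeffSubalgebra A)
    (hb : b ∈ coeffSubalgebra A) : L.br b a = -negShift D (L.br a b) :=
  skew_extend (fun i j m => L.skew_symm
    (skew_extend (fun h k n => skew_coeff_of_isAdlerType hA i j h k m n) ha)) hb

theorem integral_hamDer_hamDer_of_isAdlerType (hA : IsAdlerType L A) (i j h k s t : Fin N)
    (m n l : ℤ) (p q r : Fin 3) :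
    integralMap (jetDer D) (MvPolynomial.X (r, 0) *
      L.hamDer ((A i j).coeff m) (MvPolynomial.X (p, 0))
        (L.hamDer ((A h k).coeff n) (MvPolynomial.X (q, 0)) (MvPolynomial.C ((A s t).coeff l)))) =
      (matrixSplitting (jetDer D) N).adlerTriple (jetMatrix A) (testOp j i m (MvPolynomial.X (p, 0)))
        (testOp k h n (MvPolynomial.X (q, 0))) (testOp t s l (MvPolynomial.X (r, 0))) := by
  rw [← coeff_jetMatrix, ← coeff_mapDer, ← matrixDer_apply, ← coeff_mapDer, ← matrixDer_apply,
    ← tr_mul_testOp, matrixDer_hamDer_of_isAdlerType hA, matrixDer_adler _ (L.hamDer_comm _ _) _ _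
      (matrixDer_testOp _ (L.hamDer_comm _ _) _ _ _ _ (L.hamDer_X _ _ _)),
    matrixDer_hamDer_of_isAdlerType hA]
  rfl

theorem jacobiCycle_coeff_of_isAdlerType (hA : IsAdlerType L A) (i j h k s t : Fin N)
    (m n l : ℤ) (p q r : Fin 3) :
    L.jacobiCycle p q r ((A i j).coeff m) ((A h k).coeff n) ((A s t).coeff l) = 0 := by
  unfold jacobiCycle
  rw [integral_hamDer_hamDer_of_isAdlerType hA, integral_hamDer_hamDer_of_isAdlerType hA,
    integral_hamDer_hamDer_of_isAdlerType hA]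
  exact TracedSplitting.adlerTriple_cyclic _ _ _ _ _

/-- Closure of the subalgebra is needed here: skewsymmetry is used for `c` and the coefficients of
`{a_λ b}`. The forward direction serves to rotate the arguments. -/
theorem jacobiator_eq_zero_iff (hA : IsAdlerType L A) {a b c : V} (ha : a ∈ coeffSubalgebra A)
    (hb : b ∈ coeffSubalgebra A) (hc : c ∈ coeffSubalgebra A) :
    L.jacobiator a b c = 0 ↔ ∀ p q r, L.jacobiCycle p q r a b c = 0 := by
  have key := fun p q r => L.integral_mul_jacobiator p q r (skew_of_isAdlerType hA ha hc)
    (fun n => skew_of_isAdlerType hA (br_mem_coeffsIn_of_isAdlerType hA ha hb n) hc)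
  constructor
  · intro h p q r
    rw [← key, h, map_zero, mul_zero, map_zero]
  · intro h
    refine jetApply₂_eq_zero (D := D) (i := 0) (j := 1) (by decide) ?_
    refine eq_zero_of_integral_X_mul D 2 _
      (fun n => pderiv_jetApply₂_of_ne (by decide) (by decide) _ _) ?_
    rw [key, h]

theorem jacobiator_rotate (hA : IsAdlerType L A) {a b c : V} (ha : a ∈ coeffSubalgebra A)
    (hb : b ∈ coeffSubalgebra A) (hc : c ∈ coeffSubalgebra A) (h : L.jacobiator a b c = 0) :
    L.jacobiator b c a = 0 := by
  rw [jacobiator_eq_zero_iff hA hb hc ha]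
  intro p q r
  rw [← jacobiCycle_rotate]
  exact (jacobiator_eq_zero_iff hA ha hb hc).1 h _ _ _

/-- In its last argument the tested jacobiator is a derivation commuting with `∂`. -/
theorem jacobiator_extend {a b : V} (h : ∀ i j m, L.jacobiator a b ((A i j).coeff m) = 0) {c : V}
    (hc : c ∈ coeffSubalgebra A) : L.jacobiator a b c = 0 := by
  refine jetApply₂_eq_zero (D := D) (i := 0) (j := 1) (by decide) ?_
  rw [jetApply₂_jacobiator]
  refine derivation_eq_on_coeffSubalgebra (δ' := 0) (fun w => ?_) (fun w => (map_zero _).symm)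
    (fun i j m => ?_) hc
  · simp only [Derivation.sub_apply, Derivation.commutator_apply, hamDer_comm, nestedDer_comm,
      map_sub]
  · rw [← jetApply₂_jacobiator, h, map_zero]; rfl

theorem jacobiator_of_isAdlerType (hA : IsAdlerType L A) {a b c : V} (ha : a ∈ coeffSubalgebra A)
    (hb : b ∈ coeffSubalgebra A) (hc : c ∈ coeffSubalgebra A) : L.jacobiator a b c = 0 := by
  have hmem := coeff_mem_coeffSubalgebra A
  have h0 : ∀ i j m h k n s t l,
      L.jacobiator ((A i j).coeff m) ((A h k).coeff n) ((A s t).coeff l) = 0 :=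
    fun i j m h k n s t l => (jacobiator_eq_zero_iff hA (hmem _ _ _) (hmem _ _ _) (hmem _ _ _)).2
      fun _ _ _ => jacobiCycle_coeff_of_isAdlerType hA _ _ _ _ _ _ _ _ _ _ _ _
  -- Only the last argument extends directly, so rotations bring each of the three arguments to that
  -- place in turn.
  refine jacobiator_extend (fun s t l => ?_) hc
  refine jacobiator_rotate hA (hmem _ _ _) ha hb (jacobiator_extend (fun h k n => ?_) hb)
  exact jacobiator_rotate hA (hmem _ _ _) (hmem _ _ _) ha
    (jacobiator_extend (fun i j m => h0 _ _ _ _ _ _ _ _ _) ha)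

theorem isPVAOn_of_isAdlerType (hA : IsAdlerType L A) : L.IsPVAOn (coeffSubalgebra A) where
  closed _ ha _ hb := br_mem_coeffsIn_of_isAdlerType hA ha hb
  skew _ ha _ hb := skew_of_isAdlerType hA ha hb
  jacobi _ ha _ hb _ hc := sub_eq_zero.1 (jacobiator_of_isAdlerType hA ha hb hc)

end LambdaBracket

theorem IsBiAdlerType.isBiPVAOn {F : Type*} [Field F] {V : Type*} [CommRing V] [Algebra F V]
    {D : Derivation F V V} {N : ℕ} {L₀ L₁ : LambdaBracket D}
    {A : Matrix (Fin N) (Fin N) (PseudoDiffOp D)} (hA : IsBiAdlerType L₀ L₁ A) :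
    LambdaBracket.IsBiPVAOn L₀ L₁ (coeffSubalgebra A) := fun ε => by
  have h := LambdaBracket.isPVAOn_of_isAdlerType (hA ε)
  rwa [coeffSubalgebra_add_const] at h

/-! ### The Lenard–Magri recurrence -/

namespace LambdaBracket

open PseudoDiffOp

variable {F : Type*} [Field F] {V : Type*} [CommRing V] [Algebra F V] {D : Derivation F V V} {N : ℕ}

section Pencil

variable (L₀ L₁ : LambdaBracket D)

theorem pencil_zero : pencil L₀ L₁ 0 = L₀ := by
  cases L₀; simp [pencil]

theorem pencil_one_br (a b : V) : (pencil L₀ L₁ 1).br a b = L₀.br a b + L₁.br a b := by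
  simp [pencil]

end Pencil

theorem isAdlerType_of_isBiAdlerType {L₀ L₁ : LambdaBracket D}
    {A : Matrix (Fin N) (Fin N) (PseudoDiffOp D)} (hA : IsBiAdlerType L₀ L₁ A) :
    IsAdlerType L₀ A := by
  have h := hA 0
  have h0 : const D (0 : V) = 0 := by ext n; simp
  rw [pencil_zero, map_zero, h0] at h
  rwa [show (Matrix.diagonal fun _ : Fin N => (0 : PseudoDiffOp D)) = 0 from
    Matrix.diagonal_zero, add_zero] at h

theorem isAdlerType_pencil_one {L₀ L₁ : LambdaBracket D}
    {A : Matrix (Fin N) (Fin N) (PseudoDiffOp D)} (hA : IsBiAdlerType L₀ L₁ A) :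
    IsAdlerType (pencil L₀ L₁ 1) (A + 1) := by
  have h := hA 1
  rw [map_one] at h
  exact h

variable {L L₀ L₁ : LambdaBracket D}

theorem matrixDer_cohamDer_of_isAdlerType {A : Matrix (Fin N) (Fin N) (PseudoDiffOp D)}
    (hA : IsAdlerType L A) (h k : Fin N) (m : ℤ) (f : JetAlgebra V) :
    matrixDer (L.cohamDer ((A h k).coeff m) f) N (jetMatrix A) =
      -(matrixSplitting (jetDer D) N).adler (jetMatrix A) (jetMatrix A) (testOp k h m f) := by
  rw [← matrixDer_hamDer_of_isAdlerType hA]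
  ext i j n
  rw [Matrix.neg_apply, PseudoDiffOp.coeff_neg, matrixDer_apply, coeff_mapDer, coeff_jetMatrix,
    cohamDer_C, matrixDer_apply, coeff_mapDer, coeff_jetMatrix, hamDer_C,
    (skew_iff _ _ _).1 (skew_coeff_of_isAdlerType hA i j h k n m), neg_neg]

theorem exists_coeff_one_apply (i j : Fin N) (m : ℤ) :
    ∃ r : F, ((1 : Matrix (Fin N) (Fin N) (PseudoDiffOp D)) i j).coeff m = algebraMap F V r := by
  rw [Matrix.one_apply]
  split_ifs
  · rw [PseudoDiffOp.coeff_one]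
    split_ifs
    exacts [⟨1, by simp⟩, ⟨0, by simp⟩]
  · exact ⟨0, by simp⟩

/-- The second bracket is the difference of the pencil at `ε = 1` and at `ε = 0`. Constants have
zero bracket, so `A + 1` may replace `A` inside it. On the Adler side only the terms linear in the
added `1` survive, because `adler 1 1 x = x_+ - x_+ = 0`. -/
theorem matrixDer_cohamDer_of_isBiAdlerType {A : Matrix (Fin N) (Fin N) (PseudoDiffOp D)}
    (hA : IsBiAdlerType L₀ L₁ A) (h k : Fin N) (m : ℤ) (f : JetAlgebra V) :
    matrixDer (L₁.cohamDer ((A h k).coeff m) f) N (jetMatrix A) =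
      -((matrixSplitting (jetDer D) N).adler (jetMatrix A) 1 (testOp k h m f) +
        (matrixSplitting (jetDer D) N).adler 1 (jetMatrix A) (testOp k h m f)) := by
  have h0 := matrixDer_cohamDer_of_isAdlerType (isAdlerType_of_isBiAdlerType hA) h k m f
  have h1 := matrixDer_cohamDer_of_isAdlerType (isAdlerType_pencil_one hA) h k m f
  have hbr : ∀ i j n, (pencil L₀ L₁ 1).br (((A + 1) i j).coeff n) (((A + 1) h k).coeff m) =
      L₀.br ((A i j).coeff n) ((A h k).coeff m) + L₁.br ((A i j).coeff n) ((A h k).coeff m) := by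
    intro i j n
    obtain ⟨r, hr⟩ := exists_coeff_one_apply (F := F) (D := D) i j n
    obtain ⟨s, hs⟩ := exists_coeff_one_apply (F := F) (D := D) h k m
    have ha : ((A + 1) i j).coeff n = (A i j).coeff n + algebraMap F V r := by
      rw [← hr]; rfl
    have hb : ((A + 1) h k).coeff m = (A h k).coeff m + algebraMap F V s := by
      rw [← hs]; rfl
    rw [ha, hb, map_add, br_algebraMap_right, add_zero, map_add, LinearMap.add_apply,
      br_algebraMap_left, add_zero, pencil_one_br]
  have e : matrixDer ((pencil L₀ L₁ 1).cohamDer (((A + 1) h k).coeff m) f) N (jetMatrix (A + 1)) =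
      matrixDer (L₀.cohamDer ((A h k).coeff m) f) N (jetMatrix A) +
        matrixDer (L₁.cohamDer ((A h k).coeff m) f) N (jetMatrix A) := by
    refine Matrix.ext fun i j => PseudoDiffOp.ext (funext fun n => ?_)
    change (pencil L₀ L₁ 1).cohamDer _ f (MvPolynomial.C _) =
      L₀.cohamDer _ f (MvPolynomial.C _) + L₁.cohamDer _ f (MvPolynomial.C _)
    rw [cohamDer_C, cohamDer_C, cohamDer_C, hbr, map_add]
  rw [e, h0, neg_add_eq_iff_eq_add] at h1
  have hj : jetMatrix (A + 1) = jetMatrix A + 1 := by rw [jetMatrix, map_add, map_one]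
  rw [h1, hj]
  simp only [TracedSplitting.adler, mul_add, add_mul, map_add, mul_one, one_mul]
  abel

theorem eq_of_integral_X_mul_C {x y : V}
    (h : integralMap (jetDer D) (MvPolynomial.X (0, 0) * MvPolynomial.C x) =
      integralMap (jetDer D) (MvPolynomial.X (0, 0) * MvPolynomial.C y)) : x = y := by
  have h0 : (MvPolynomial.C (x - y) : JetAlgebra V) = 0 :=
    eq_zero_of_integral_X_mul D 0 _ (fun n => MvPolynomial.pderiv_C) (by
      rw [map_sub, mul_sub, map_sub, h, sub_self])
  exact sub_eq_zero.1 (MvPolynomial.C_injective _ _ (by rw [h0, map_zero]))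

/-- The gradient of `∫h_{n,B}` with respect to `A` is `-B ^ (n - K)`: the normalisation `-K / n`
cancels the factors in `trace_derivation_root`. The morphism `φ` allows use both over the jet
algebra and over `V` itself. -/
theorem integral_derivation_hDensity [CharZero F] {A B : (Matrix (Fin N) (Fin N) (PseudoDiffOp D))ˣ}
    {K : ℤ} (hB : IsOperatorRoot A B K) {n : ℤ} (hn : n ≠ 0) {W : Type*} [CommRing W] [Algebra F W]
    {E : Derivation F W W} (φ : V →ₐ[F] W) (hφ : ∀ v, φ (D v) = E (φ v)) (δ : Derivation F W W)
    (hδ : ∀ w, δ (E w) = E (δ w)) :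
    integralMap E (δ (φ (hDensity K B n))) =
      -(matrixSplitting E N).tr ((mapHom φ hφ).mapMatrix (B ^ (n - K)).val *
        matrixDer δ N ((mapHom φ hφ).mapMatrix A.val)) := by
  set ψ : Matrix (Fin N) (Fin N) (PseudoDiffOp D) →+* Matrix (Fin N) (Fin N) (PseudoDiffOp E) :=
    (mapHom φ hφ).mapMatrix
  have h := trace_derivation_root (matrixSplitting E N).tr (matrixSplitting E N).tr_mul_comm
    (matrixDer δ N) (matrixDer_mul δ hδ) (Units.map ψ.toMonoidHom B) n K
  have hpow : ∀ n : ℤ, (((Units.map ψ.toMonoidHom B) ^ n :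
      (Matrix (Fin N) (Fin N) (PseudoDiffOp E))ˣ) : Matrix _ _ _) = ψ (B ^ n).val := fun n => by
    rw [← map_zpow]; rfl
  rw [hpow, hpow, hpow, hB.2] at h
  have htr : φ ((Matrix.trace (B ^ n).val).coeff (-1)) =
      (Matrix.trace (ψ (B ^ n).val)).coeff (-1) := by
    simp only [Matrix.trace, Matrix.diag_apply, PseudoDiffOp.coeff_sum]
    exact map_sum φ _ _
  rw [hDensity, if_neg hn, map_smul, Derivation.map_smul, map_smul, htr,
    integral_derivation_residue_trace]
  have hn' : (n : F) ≠ 0 := Int.cast_ne_zero.2 hn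
  rw [← Int.cast_smul_eq_zsmul F, ← Int.cast_smul_eq_zsmul F] at h
  rw [neg_div, neg_smul, div_eq_inv_mul, mul_smul, h, smul_smul, inv_mul_cancel₀ hn', one_smul]

/-- The coefficients of `B` may lie outside `V_1`, where skewsymmetry is not available. The
derivation `h ↦ {h_∂ u}^* f` differentiates in the left argument directly and avoids it. -/
theorem integral_X_mul_action [CharZero F] {A B : (Matrix (Fin N) (Fin N) (PseudoDiffOp D))ˣ}
    {K : ℤ} (hB : IsOperatorRoot A B K) {n : ℤ} (hn : n ≠ 0) (u : V) :
    integralMap (jetDer D) (MvPolynomial.X (0, 0) *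
      MvPolynomial.C (L.action (integralMap D (hDensity K B n)) u)) =
      -(matrixSplitting (jetDer D) N).tr (jetMatrix (B ^ (n - K)).val *
        matrixDer (L.cohamDer u (MvPolynomial.X (0, 0))) N (jetMatrix A.val)) := by
  have h := integral_derivation_hDensity hB hn (jetC F V) (jetC_comm D)
    (L.cohamDer u (MvPolynomial.X (0, 0))) (L.cohamDer_comm _ _)
  rw [jetC_apply, cohamDer_C, integral_jetCoeval] at h
  exact h

theorem zpow_commute_root {A B : (Matrix (Fin N) (Fin N) (PseudoDiffOp D))ˣ} {K : ℤ}
    (hB : IsOperatorRoot A B K) (n : ℤ) : (B ^ n).val * A.val = A.val * (B ^ n).val := by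
  rw [← Units.val_mul, ← Units.val_mul, ← hB.2, ← zpow_add, ← zpow_add, add_comm]

theorem tr_laxCommutator (A B : (Matrix (Fin N) (Fin N) (PseudoDiffOp D))ˣ) (n : ℤ) (h k : Fin N)
    (m : ℤ) (f : JetAlgebra V) :
    (matrixSplitting (jetDer D) N).tr
      (((matrixSplitting (jetDer D) N).pos (jetMatrix (B ^ n).val) * jetMatrix A.val -
        jetMatrix A.val * (matrixSplitting (jetDer D) N).pos (jetMatrix (B ^ n).val)) *
        testOp k h m f) =
      integralMap (jetDer D) (f * MvPolynomial.C ((laxCommutator A B n h k).coeff m)) := by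
  have hpos : (matrixSplitting (jetDer D) N).pos (jetMatrix (B ^ n).val) =
      jetMatrix ((B ^ n).val.map PseudoDiffOp.pos) := by
    ext i j p
    rw [matrixSplitting_pos_apply, Matrix.map_apply, coeff_pos, coeff_jetMatrix, coeff_jetMatrix,
      Matrix.map_apply, coeff_pos]
    split_ifs <;> simp
  rw [tr_mul_testOp, hpos, ← map_mul, ← map_mul, ← map_sub]
  rfl

/-- `{∫h_{n,B}, A(z)}_0 = [(B ^ n)_+, A](z)`. -/
theorem action_hDensity_zero [CharZero F] {A B : (Matrix (Fin N) (Fin N) (PseudoDiffOp D))ˣ} {K : ℤ}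
    (hA : IsAdlerType L A.val) (hB : IsOperatorRoot A B K) (n : ℤ) (h k : Fin N) (m : ℤ) :
    L.action (integralMap D (hDensity K B n)) ((A.val h k).coeff m) =
      (laxCommutator A B n h k).coeff m := by
  by_cases hn : n = 0
  · subst hn
    have h1 : (1 : Matrix (Fin N) (Fin N) (PseudoDiffOp D)).map PseudoDiffOp.pos = 1 := by
      ext i j p
      rw [Matrix.map_apply, coeff_pos, Matrix.one_apply]
      split_ifs with h1 h2 <;> simp [PseudoDiffOp.coeff_one]
      omega
    rw [laxCommutator, zpow_zero, Units.val_one, h1, Ring.lie_def, one_mul, mul_one, sub_self,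
      hDensity, if_pos rfl, map_zero, map_zero]
    rfl
  · apply eq_of_integral_X_mul_C (D := D)
    have hc := zpow_commute_root hB (n - K)
    have hc' : jetMatrix (B ^ (n - K)).val * jetMatrix A.val =
        jetMatrix A.val * jetMatrix (B ^ (n - K)).val := by
      rw [← map_mul, hc, map_mul]
    rw [integral_X_mul_action hB hn, matrixDer_cohamDer_of_isAdlerType hA, mul_neg,
      map_neg, neg_neg, TracedSplitting.tr_mul_adler _ _ _ _ hc', ← tr_laxCommutator, ← map_mul]
    have : (B ^ (n - K)).val * A.val = (B ^ n).val := by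
      rw [← hB.2, ← Units.val_mul, ← zpow_add, sub_add_cancel]
    rw [this]

/-- `{∫h_{n+K,B}, A(z)}_1 = [(B ^ n)_+, A](z)` for `n ≠ -K`. -/
theorem action_hDensity_one [CharZero F] {A B : (Matrix (Fin N) (Fin N) (PseudoDiffOp D))ˣ} {K : ℤ}
    (hA : IsBiAdlerType L₀ L₁ A.val) (hB : IsOperatorRoot A B K) {n : ℤ} (hn : n ≠ -K) (h k : Fin N)
    (m : ℤ) :
    L₁.action (integralMap D (hDensity K B (n + K))) ((A.val h k).coeff m) =
      (laxCommutator A B n h k).coeff m := by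
  apply eq_of_integral_X_mul_C (D := D)
  have hc' : jetMatrix (B ^ n).val * jetMatrix A.val = jetMatrix A.val * jetMatrix (B ^ n).val := by
    rw [← map_mul, zpow_commute_root hB n, map_mul]
  -- The gradient of `h_{n+K}` has exponent `(n + K) - K = n`; the condition `n ≠ -K` keeps the
  -- index `n + K` away from zero.
  rw [integral_X_mul_action hB (by omega), matrixDer_cohamDer_of_isBiAdlerType hA, mul_neg, map_neg,
    neg_neg, add_sub_cancel_right, TracedSplitting.tr_mul_adler_one _ _ _ _ hc', ← tr_laxCommutator]

/-! ### Commuting Hamiltonian flows -/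

theorem action_leibniz (L : LambdaBracket D) (f : LocalFunctional D) (a b : V) :
    L.action f (a * b) = a * L.action f b + b * L.action f a := by
  obtain ⟨f, rfl⟩ := Submodule.mkQ_surjective _ f
  change (L.br f (a * b)).coeff 0 = a * (L.br f b).coeff 0 + b * (L.br f a).coeff 0
  rw [L.leibniz_right, Polynomial.coeff_add, coeff_C_mul, coeff_C_mul, add_comm]

theorem action_comm (L : LambdaBracket D) (f : LocalFunctional D) (a : V) :
    L.action f (D a) = D (L.action f a) := by
  obtain ⟨f, rfl⟩ := Submodule.mkQ_surjective _ f
  change (L.br f (D a)).coeff 0 = D ((L.br f a).coeff 0)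
  rw [L.sesq_right, coeff_lambdaAdd]
  simp

/-- The Hamiltonian derivation `{∫f, ·}` of `V`. -/
noncomputable def actionDer (L : LambdaBracket D) (f : LocalFunctional D) : Derivation F V V :=
  Derivation.mk' (L.action f) (L.action_leibniz f)

theorem actionDer_apply (L : LambdaBracket D) (f : LocalFunctional D) (v : V) :
    L.actionDer f v = L.action f v := rfl

theorem functionalBracket_integral_right (L : LambdaBracket D) (f : LocalFunctional D) (g : V) :
    L.functionalBracket f (integralMap D g) = integralMap D (L.action f g) := rfl

/-- A Lax equation `dA/dt = [P, A]` conserves all the functionals `∫h_{n,C}`. -/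
theorem functionalBracket_eq_zero_of_lax [CharZero F]
    {A C : (Matrix (Fin N) (Fin N) (PseudoDiffOp D))ˣ} {K : ℤ} (hC : IsOperatorRoot A C K)
    (L : LambdaBracket D) (f : LocalFunctional D) (P : Matrix (Fin N) (Fin N) (PseudoDiffOp D))
    (hP : ∀ h k m, L.action f ((A.val h k).coeff m) = (⁅P, A.val⁆ h k).coeff m) (n : ℤ) :
    L.functionalBracket f (integralMap D (hDensity K C n)) = 0 := by
  by_cases hn : n = 0
  · subst hn
    rw [hDensity, if_pos rfl, map_zero, map_zero]
  have h := integral_derivation_hDensity hC hn (AlgHom.id F V) (fun _ => rfl) (L.actionDer f)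
    (L.action_comm f)
  rw [AlgHom.id_apply, actionDer_apply] at h
  rw [functionalBracket_integral_right, h]
  have hid : ∀ M : Matrix (Fin N) (Fin N) (PseudoDiffOp D),
      (mapHom (E := D) (AlgHom.id F V) (fun _ => rfl)).mapMatrix M = M := fun M => rfl
  have hd : matrixDer (L.actionDer f) N A.val = P * A.val - A.val * P := by
    ext h k m
    exact hP h k m
  -- `C ^ (n - K)` commutes with `A`, so cyclicity gives `tr (C ^ (n - K) [P, A]) = 0`.
  rw [hid, hid, hd, mul_sub, map_sub, ← mul_assoc, ← mul_assoc, zpow_commute_root hC, mul_assoc,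
    (matrixSplitting D N).tr_mul_comm, (matrixSplitting D N).tr_mul_comm (A.val * _),
    mul_assoc P, sub_self, neg_zero]

theorem functionalBracket_hDensity [CharZero F] {A B C : (Matrix (Fin N) (Fin N) (PseudoDiffOp D))ˣ}
    (hA : IsBiAdlerType L₀ L₁ A.val) {K₁ K₂ : ℤ} (hB : IsOperatorRoot A B K₁)
    (hC : IsOperatorRoot A C K₂) (m n : ℤ) :
    L₀.functionalBracket (integralMap D (hDensity K₁ B m)) (integralMap D (hDensity K₂ C n)) = 0 ∧
      L₁.functionalBracket (integralMap D (hDensity K₁ B m)) (integralMap D (hDensity K₂ C n)) =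
        0 := by
  refine ⟨functionalBracket_eq_zero_of_lax hC L₀ _ _
    (action_hDensity_zero (isAdlerType_of_isBiAdlerType hA) hB m) n, ?_⟩
  -- For the second bracket `h_m` generates the Lax flow of index `m - K₁`. The recurrence misses
  -- only `m = 0`, where `h_0 = 0`.
  by_cases hm : m = 0
  · subst hm
    rw [hDensity, if_pos rfl, functionalBracket_integral_right, map_zero, map_zero,
      LinearMap.zero_apply, map_zero]
  · have := action_hDensity_one hA hB (n := m - K₁) (by omega)
    rw [sub_add_cancel] at this
    exact functionalBracket_eq_zero_of_lax hC L₁ _ _ this n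

theorem action_eq_on_coeffSubalgebra {A : Matrix (Fin N) (Fin N) (PseudoDiffOp D)}
    {f g : LocalFunctional D}
    (h : ∀ i j m, L₀.action f ((A i j).coeff m) = L₁.action g ((A i j).coeff m)) {u : V}
    (hu : u ∈ coeffSubalgebra A) : L₀.action f u = L₁.action g u := by
  refine coeffSubalgebra_induction (p := fun u => L₀.action f u = L₁.action g u) (fun r => ?_) h
    (fun v hv => ?_) (fun u v hu hv => ?_) (fun u v hu hv => ?_) hu
  · exact ((L₀.actionDer f).map_algebraMap r).trans ((L₁.actionDer g).map_algebraMap r).symm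
  · rw [action_comm, action_comm, hv]
  · rw [map_add, map_add, hu, hv]
  · rw [action_leibniz, action_leibniz, hu, hv]

/-- The Jacobi identity at `λ = μ = 0`. -/
theorem IsPVAOn.action_commutator {S : Subalgebra F V} (hL : L.IsPVAOn S) {a b c : V} (ha : a ∈ S)
    (hb : b ∈ S) (hc : c ∈ S) :
    L.action (integralMap D a) (L.action (integralMap D b) c) -
        L.action (integralMap D b) (L.action (integralMap D a) c) =
      L.action (L.functionalBracket (integralMap D a) (integralMap D b)) c := by
  -- `e` evaluates at `λ = μ = 0`, which leaves the constant term of each inner and outer bracket.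
  set e : V[X][X] →+* V := (constantCoeff (R := V)).comp (constantCoeff (R := V[X])) with he
  have eX : e X = 0 := by simp [he]
  have eC : ∀ p : V[X], e (C p) = p.coeff 0 := fun p => by simp [he]
  have eM : ∀ p : V[X], e (p.map C) = p.coeff 0 := fun p => by simp [he]
  have eE : ∀ p : V[X], e (p.eval₂ (C.comp C) (C X + X)) = p.coeff 0 := fun p => by
    rw [hom_eval₂, map_add, eC, coeff_X_zero, eX, add_zero, eval₂_at_zero]
    simp [he]
  clear_value e
  have h := congrArg e (hL.jacobi a ha b hb c hc)
  have h1 : ∀ (p : V[X]) (T : ℕ → V → V), T 0 0 = 0 → (∀ n r, n ≠ 0 → T n r = 0) →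
      ∑ n ∈ p.support, T n (p.coeff n) = T 0 (p.coeff 0) := fun p T h0 hT =>
    Finset.sum_eq_single 0 (fun n _ hn => hT n _ hn) fun hn => by
      rw [notMem_support_iff.1 hn, h0]
  simp only [Polynomial.sum, map_sub, map_sum, map_mul, map_pow, eC, eX, eM, eE, coeff_X_zero] at h
  rw [h1 _ (fun n r => (L.br a r).coeff 0 * 0 ^ n) (by simp) (fun n r hn => by simp [hn]),
    h1 _ (fun n r => (L.br b r).coeff 0 * 0 ^ n) (by simp) (fun n r hn => by simp [hn]),
    h1 _ (fun n r => 0 ^ n * (L.br r c).coeff 0) (by simp) (fun n r hn => by simp [hn])] at h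
  simp only [pow_zero, mul_one, one_mul] at h
  exact h

theorem actions_commute_of_isPVAOn {S : Subalgebra F V} (hL : L.IsPVAOn S) {a b c : V} (ha : a ∈ S)
    (hb : b ∈ S) (hc : c ∈ S)
    (h0 : L.functionalBracket (integralMap D a) (integralMap D b) = 0) :
    L.action (integralMap D a) (L.action (integralMap D b) c) =
      L.action (integralMap D b) (L.action (integralMap D a) c) := by
  rw [← sub_eq_zero, hL.action_commutator ha hb hc, h0, map_zero, LinearMap.zero_apply]

theorem pencil_action_integral (L₀ L₁ : LambdaBracket D) (ε : F) (a b : V) :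
    (pencil L₀ L₁ ε).action (integralMap D a) b =
      L₀.action (integralMap D a) b + ε • L₁.action (integralMap D a) b := by
  simp [pencil]

theorem IsBiPVAOn.action_mem {S : Subalgebra F V} (h : IsBiPVAOn L₀ L₁ S) {a b : V} (ha : a ∈ S)
    (hb : b ∈ S) :
    L₀.action (integralMap D a) b ∈ S ∧ L₁.action (integralMap D a) b ∈ S := by
  have h0 := (h 0).closed a ha b hb 0
  have h1 := (h 1).closed a ha b hb 0
  rw [← action_integral, pencil_action_integral] at h0 h1
  rw [zero_smul, add_zero] at h0
  rw [one_smul] at h1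
  exact ⟨h0, by simpa using S.sub_mem h1 h0⟩

theorem IsBiPVAOn.actions_commute [CharZero F] {S : Subalgebra F V} (h : IsBiPVAOn L₀ L₁ S)
    {a b c : V} (ha : a ∈ S) (hb : b ∈ S) (hc : c ∈ S)
    (h0 : L₀.functionalBracket (integralMap D a) (integralMap D b) = 0)
    (h1 : L₁.functionalBracket (integralMap D a) (integralMap D b) = 0) :
    L₀.action (integralMap D a) (L₀.action (integralMap D b) c) =
        L₀.action (integralMap D b) (L₀.action (integralMap D a) c) ∧
      L₁.action (integralMap D a) (L₁.action (integralMap D b) c) =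
        L₁.action (integralMap D b) (L₁.action (integralMap D a) c) := by
  -- The commutator of the pencil flows is quadratic in `ε`. The values at `1` and `-1`, minus twice
  -- the value at `0`, isolate twice the coefficient of `ε ^ 2`, which is the commutator for the
  -- second bracket.
  have key : ∀ ε : F, _ := fun ε => actions_commute_of_isPVAOn (h ε) ha hb hc (by
    rw [functionalBracket_integral_right] at h0 h1 ⊢
    rw [pencil_action_integral, map_add, map_smul, h0, h1, smul_zero, add_zero])
  simp only [pencil_action_integral, map_add, map_smul, smul_add] at key
  have k0 := key 0
  have k1 := key 1
  have k2 := key (-1)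
  simp only [zero_smul, add_zero] at k0
  refine ⟨k0, ?_⟩
  simp only [one_smul, neg_smul, smul_neg, neg_neg] at k1 k2
  have k3 : (2 : F) • L₁.action (integralMap D a) (L₁.action (integralMap D b) c) =
      (2 : F) • L₁.action (integralMap D b) (L₁.action (integralMap D a) c) := by
    rw [two_smul, two_smul]
    linear_combination k1 + k2 - 2 * k0
  exact smul_right_injective V (two_ne_zero (α := F)) k3

end LambdaBracket

/-! ### The main theorem. -/

open LambdaBracket in
theorem theorem5p2 {F : Type*} [Field F] [CharZero F] {V : Type*} [CommRing V] [Algebra F V]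
    (D : Derivation F V V) (L₀ L₁ : LambdaBracket D) {N : ℕ}
    (A : (Matrix (Fin N) (Fin N) (PseudoDiffOp D))ˣ)
    (hA : IsBiAdlerType L₀ L₁ (A : Matrix (Fin N) (Fin N) (PseudoDiffOp D))) :
    -- the generalized Lenard-Magri recurrence, for every root of `A`
    (∀ (K : ℤ) (B : (Matrix (Fin N) (Fin N) (PseudoDiffOp D))ˣ), IsOperatorRoot A B K →
      ∀ (n : ℤ) (h k : Fin N) (m : ℤ),
        L₀.action (integralMap D (hDensity K B n)) ((A.val h k).coeff m) =
            (laxCommutator A B n h k).coeff m ∧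
          (n ≠ -K → L₁.action (integralMap D (hDensity K B (n + K))) ((A.val h k).coeff m) =
            (laxCommutator A B n h k).coeff m)) ∧
    -- the coefficients of `A` generate a bi-PVA
    LambdaBracket.IsBiPVAOn L₀ L₁ (coeffSubalgebra A.val) ∧
    -- on which the equations of the hierarchy are bi-Hamiltonian
    (∀ (K : ℤ) (B : (Matrix (Fin N) (Fin N) (PseudoDiffOp D))ˣ), IsOperatorRoot A B K →
      ∀ n : ℤ, n ≠ -K → ∀ u ∈ coeffSubalgebra A.val,
        L₀.action (integralMap D (hDensity K B n)) u =
          L₁.action (integralMap D (hDensity K B (n + K))) u) ∧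
    -- the Hamiltonian functionals of all roots are in involution for both brackets, hence
    -- integrals of motion of all the equations
    (∀ (K₁ K₂ : ℤ) (B C : (Matrix (Fin N) (Fin N) (PseudoDiffOp D))ˣ),
      IsOperatorRoot A B K₁ → IsOperatorRoot A C K₂ → ∀ m n : ℤ,
        L₀.functionalBracket (integralMap D (hDensity K₁ B m)) (integralMap D (hDensity K₂ C n)) = 0 ∧
        L₁.functionalBracket (integralMap D (hDensity K₁ B m)) (integralMap D (hDensity K₂ C n)) = 0) ∧
    -- the equations with Hamiltonian functionals of the bi-PVA are flows on it, and they commute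
    (∀ (K₁ K₂ : ℤ) (B C : (Matrix (Fin N) (Fin N) (PseudoDiffOp D))ˣ),
      IsOperatorRoot A B K₁ → IsOperatorRoot A C K₂ → ∀ m n : ℤ,
        (∃ f ∈ coeffSubalgebra A.val, integralMap D f = integralMap D (hDensity K₁ B m)) →
        (∃ g ∈ coeffSubalgebra A.val, integralMap D g = integralMap D (hDensity K₂ C n)) →
        ∀ L : LambdaBracket D, L = L₀ ∨ L = L₁ → ∀ u ∈ coeffSubalgebra A.val,
          L.action (integralMap D (hDensity K₁ B m)) u ∈ coeffSubalgebra A.val ∧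
          L.action (integralMap D (hDensity K₁ B m))
              (L.action (integralMap D (hDensity K₂ C n)) u) =
            L.action (integralMap D (hDensity K₂ C n))
              (L.action (integralMap D (hDensity K₁ B m)) u)) := by
  have hPVA := hA.isBiPVAOn
  have hA₀ := isAdlerType_of_isBiAdlerType hA
  refine ⟨fun K B hB n h k m => ⟨action_hDensity_zero hA₀ hB n h k m,
      fun hn => action_hDensity_one hA hB hn h k m⟩, hPVA,
    fun K B hB n hn u hu => action_eq_on_coeffSubalgebra (fun i j m => ?_) hu,
    fun K₁ K₂ B C hB hC m n => functionalBracket_hDensity hA hB hC m n, ?_⟩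
  · rw [action_hDensity_zero hA₀ hB, action_hDensity_one hA hB hn]
  · rintro K₁ K₂ B C hB hC m n ⟨f, hf, hfB⟩ ⟨g, hg, hgC⟩ L hL u hu
    obtain ⟨h0, h1⟩ := functionalBracket_hDensity hA hB hC m n
    -- The flows depend only on the functionals, so the densities are exchanged for representatives
    -- in `V_1`, where the PVA axioms hold.
    rw [← hfB, ← hgC] at h0 h1 ⊢
    have hmem := hPVA.action_mem hf hu
    have hcomm := hPVA.actions_commute hf hg hu h0 h1
    rcases hL with rfl | rfl
    exacts [⟨hmem.1, hcomm.1⟩, ⟨hmem.2, hcomm.2⟩]
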